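/- Let $A_0$ be an unbounded nonnegative self-adjoint operator in a complex Hilbert space $\mathfrak H$ with scalar product $(\cdot,\cdot)$, linear in the first argument. For $k=1,2$ let $\mathfrak H_k=\mathcal D(A_0^{k/2})$ with norm $\|u\|_k=\|(A_0+I)^{k/2}u\|$, and let $\mathfrak H_{-k}\supset\mathfrak H$ be its dual, so that $\mathfrak H_2\subset\mathfrak H_1\subset\mathfrak H\subset\mathfrak H_{-1}\subset\mathfrak H_{-2}$; let $\langle\cdot,\cdot\rangle$ denote the pairing of $\mathfrak H_{-2}$ and $\mathfrak H_2$, linear in the second argument, with $\langle x,u\rangle=(u,x)$ for $x\in\mathfrak H$. Let $\psi\in\mathfrak H_{-2}\setminus\mathfrak H$ and let $h=(\mathbb A_0+I)^{-1}\psi\in\mathfrak H$, i.e. $\langle\psi,u\rangle=((A_0+I)u,h)$ for all $u\in\mathcal D(A_0)$. Let $A_{\mathrm{sym}}$ be the restriction of $A_0$ to $\{u\in\mathcal D(A_0):\langle\psi,u\rangle=0\}$, a closed densely defined nonnegative symmetric operator, with Friedrichs extension $A_F$ and Krein--von Neumann extension $A_N$; then $\mathcal D(A_{\mathrm{sym}}^*)=\{u+\alpha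 h: u\in\mathcal D(A_0),\ \alpha\in\mathbb C\}$. For $r\in\mathbb R$ put $\langle\psi^{\mathrm{ex}},u+\alpha h\rangle=\langle\psi,u\rangle+\alpha r$. The number $r$ is called admissible if either $\psi\notin\mathfrak H_{-1}$, or $\psi\in\mathfrak H_{-1}$ and $\langle\psi^{\mathrm{ex}},f\rangle=((A_0+I)^{1/2}f,(A_0+I)^{1/2}h)$ for all $f\in\mathcal D(A_{\mathrm{sym}}^*)\cap\mathfrak H_1$. An admissible operator for the regularization of the rank-one singular perturbation $A_0+b\langle\psi,\cdot\rangle\psi$ is an operator of the form $A_{\mathrm{sym}}^*\upharpoonright\ker\langle\psi^{\mathrm{ex}},\cdot\rangle$ with admissible $r$. Let $\mathfrak T\subset\mathbb R$ and let $\mathfrak U=\{U_t\}_{t\in\mathfrak T}$ be a family of unitary operators in $\mathfrak H$ such that $U_t^*\in\mathfrak U$ for every $t\in\mathfrak T$. For a function $p:\mathfrak T\to\mathbb R$, an operator $A\neq0$ is $p(t)$-homogeneous if $U_tA=p(t)AU_t$ (with equality of domains) for all $t\in\mathfrak T$. Assume that $A_0$ is $p(t)$-homogeneous and that $\psi$ is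 $\xi(t)$-invariant for a function $\xi:\mathfrak T\to\mathbb R$, that is, $\mathbb U_t\psi=\xi(t)\psi$ for all $t\in\mathfrak T$, where $\mathbb U_t$ is the continuation of $U_t$ to $\mathfrak H_{-2}$, acting by $\langle\mathbb U_t\psi,u\rangle=\langle\psi,U_t^*u\rangle$. Consider the equation $$(\xi(t)^2-p(t))\,r=\xi(t)\,(1-p(t))\,(h,U_th)\qquad\text{for all }t\in\mathfrak T,\tag{$*$}$$ where a solution is a real number $r$ that does not depend on $t$. 1. If $(*)$ has no solution, then $A_0=A_F=A_N$, this is the only $p(t)$-homogeneous self-adjoint extension of $A_{\mathrm{sym}}$, and every self-adjoint extension of $A_{\mathrm{sym}}$ different from $A_0$ has a negative eigenvalue. 2. If $(*)$ has at least two solutions, then all self-adjoint extensions of $A_{\mathrm{sym}}$ are $p(t)$-homogeneous. 3. If $(*)$ has exactly one solution, then $A_{\mathrm{sym}}$ has exactly two $p(t)$-homogeneous self-adjoint extensions, namely $A_F$ and $A_N$ (in particular $A_F\ne A_N$). One of them is $A_0$, and the other is the unique $p(t)$-homogeneous admissible operator $\widetilde A$ for the regularization of $A_0+b\langle\psi,\cdot\rangle\psi$.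 More precisely, $A_0=A_F$ and $\widetilde A=A_N$ if $\psi\in\mathfrak H_{-2}\setminus\mathfrak H_{-1}$, while $A_0=A_N$ and $\widetilde A=A_F$ if $\psi\in\mathfrak H_{-1}$. -/

import Mathlib

open Filter Topology ComplexConjugate

namespace RankOneSymmetry

section General

attribute [local instance 10000] InnerProductSpace.toInner

variable {H : Type*} [NormedAddCommGroup H] [InnerProductSpace ℂ H]

/-! Mathlib's inner product `inner ℂ x y` is conjugate-linear in `x` and linear in `y`,
so the scalar product `(x, y)` of the literature, linear in `x`, is `inner ℂ y x`. -/

/-- The operator `A` is nonnegative: `(A x, x) ≥ 0` on its domain. -/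
def IsNonneg (A : H →ₗ.[ℂ] H) : Prop :=
  ∀ x : A.domain, 0 ≤ (inner ℂ (A x) (x : H)).re

/-- The quadratic form `(A x, x)`. -/
noncomputable def quadForm (A : H →ₗ.[ℂ] H) (x : A.domain) : ℝ :=
  (inner ℂ (A x) (x : H)).re

/-- `(A (a m - a n), a m - a n) → 0` as `m, n → ∞`. -/
def FormCauchy (A : H →ₗ.[ℂ] H) (a : ℕ → A.domain) : Prop :=
  Tendsto (fun k : ℕ × ℕ => quadForm A (a k.1 - a k.2)) atTop (𝓝 0)

theorem quadForm_add_le {A : H →ₗ.[ℂ] H} (hA : IsNonneg A) (x y : A.domain) :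
    quadForm A (x + y) ≤ 2 * quadForm A x + 2 * quadForm A y := by
  have h := hA (x - y)
  simp only [quadForm, A.map_add, A.map_sub, Submodule.coe_add, Submodule.coe_sub,
    inner_add_left, inner_add_right, inner_sub_left, inner_sub_right,
    Complex.add_re, Complex.sub_re] at h ⊢
  linarith

theorem quadForm_smul (A : H →ₗ.[ℂ] H) (c : ℂ) (x : A.domain) :
    quadForm A (c • x) = ‖c‖ ^ 2 * quadForm A x := by
  simp only [quadForm, A.map_smul, Submodule.coe_smul, inner_smul_left, inner_smul_right]
  rw [← mul_assoc, Complex.mul_conj']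
  norm_cast
  rw [Complex.re_ofReal_mul]

theorem FormCauchy.add {A : H →ₗ.[ℂ] H} (hA : IsNonneg A) {a b : ℕ → A.domain}
    (ha : FormCauchy A a) (hb : FormCauchy A b) : FormCauchy A (fun n => a n + b n) := by
  have h : Tendsto (fun k : ℕ × ℕ => 2 * quadForm A (a k.1 - a k.2)
      + 2 * quadForm A (b k.1 - b k.2)) atTop (𝓝 0) := by
    simpa using (ha.const_mul 2).add (hb.const_mul 2)
  refine squeeze_zero (fun k => hA _) (fun k => ?_) h
  rw [add_sub_add_comm]
  exact quadForm_add_le hA _ _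

theorem FormCauchy.smul {A : H →ₗ.[ℂ] H} (c : ℂ) {a : ℕ → A.domain}
    (ha : FormCauchy A a) : FormCauchy A (fun n => c • a n) := by
  unfold FormCauchy at ha ⊢
  simp only [← smul_sub, quadForm_smul]
  simpa using ha.const_mul (‖c‖ ^ 2)

theorem FormCauchy.zero (A : H →ₗ.[ℂ] H) : FormCauchy A (fun _ => 0) := by
  simp [FormCauchy, quadForm]

/-- `a n → f` both in `H` and in the norm of the (closed) quadratic form of `A`. -/
def IsFormLimit (A : H →ₗ.[ℂ] H) (a : ℕ → A.domain) (f : H) : Prop :=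
  Tendsto (fun n => (a n : H)) atTop (𝓝 f) ∧ FormCauchy A a

/-- The domain of the closure of the quadratic form `(A x, x)` of a nonnegative operator: the
completion, inside `H`, of the domain of `A` in the norm `((A x, x) + ‖x‖²)^(1/2)`.
For a nonnegative self-adjoint `A` it is the domain of `A^(1/2)`. -/
def formDomain (A : H →ₗ.[ℂ] H) (hA : IsNonneg A) : Submodule ℂ H where
  carrier := {f | ∃ a : ℕ → A.domain, IsFormLimit A a f}
  zero_mem' := ⟨fun _ => 0, by simp, FormCauchy.zero A⟩
  add_mem' := by
    rintro f g ⟨a, ha, ha'⟩ ⟨b, hb, hb'⟩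
    exact ⟨fun n => a n + b n, by simpa using ha.add hb, ha'.add hA hb'⟩
  smul_mem' := by
    rintro c f ⟨a, ha, ha'⟩
    exact ⟨fun n => c • a n, by simpa using ha.const_smul c, ha'.smul c⟩

/-- The restriction `A ↾ {u ∈ D(A) : ψ u = 0}` of an operator to the kernel of a functional. -/
def restrictKer (A : H →ₗ.[ℂ] H) (ψ : A.domain →ₗ⋆[ℂ] ℂ) : H →ₗ.[ℂ] H :=
  A.domRestrict ((LinearMap.ker ψ).map A.domain.subtype)

theorem restrictKer_isNonneg {A : H →ₗ.[ℂ] H} (hA : IsNonneg A) (ψ : A.domain →ₗ⋆[ℂ] ℂ) :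
    IsNonneg (restrictKer A ψ) := by
  intro x
  have h : restrictKer A ψ x = A ⟨x, x.2.2⟩ := LinearPMap.domRestrict_apply rfl
  rw [h]
  exact hA ⟨x, x.2.2⟩

/-- `B` has a negative eigenvalue. -/
def HasNegativeEigenvalue (B : H →ₗ.[ℂ] H) : Prop :=
  ∃ z : ℝ, z < 0 ∧ ∃ x : B.domain, (x : H) ≠ 0 ∧ B x = (z : ℂ) • (x : H)

/-- The nonzero operator `A` is `p(t)`-homogeneous with respect to the family `U`:
`U_t A = p(t) A U_t` for all `t`, as an equality of operators (domains included). -/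
def IsHomogeneous {T : Set ℝ} (U : T → H ≃ₗᵢ[ℂ] H) (p : T → ℝ) (A : H →ₗ.[ℂ] H) : Prop :=
  (∃ x : A.domain, A x ≠ 0) ∧
    ∀ t : T, (∀ x : H, x ∈ A.domain ↔ U t x ∈ A.domain) ∧
      ∀ (x : H) (hx : x ∈ A.domain) (hx' : U t x ∈ A.domain),
        U t (A ⟨x, hx⟩) = (p t : ℂ) • A ⟨U t x, hx'⟩

/-! ### The scale of spaces of a nonnegative self-adjoint operator

Elements of `ℋ₋₂(A)` are realised as the antilinear functionals on `ℋ₂(A) = D(A)` that are bounded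
in the norm `‖(A + I) u‖`; the pairing linear in `u` is `⟨ψ, u⟩ = conj (ψ u)`. -/

/-- The embedding of `H` into the antidual of `D(A)`, given by `⟨x, u⟩ = (u, x)`. -/
def embed (A : H →ₗ.[ℂ] H) (x : H) : A.domain →ₗ⋆[ℂ] ℂ where
  toFun u := inner ℂ (u : H) x
  map_add' u v := by simp [inner_add_left]
  map_smul' c u := by simp [inner_smul_left]

/-- `ℋ₋₂(A)`: bounded for the norm `‖u‖₂ = ‖(A + I) u‖`. -/
def HMinusTwo (A : H →ₗ.[ℂ] H) : Set (A.domain →ₗ⋆[ℂ] ℂ) :=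
  {ψ | ∃ C : ℝ, ∀ u : A.domain, ‖ψ u‖ ≤ C * ‖A u + (u : H)‖}

/-- `ℋ₋₁(A)`: bounded on `D(A)`, which is dense in `ℋ₁(A) = D(A^(1/2))`, for the norm
`‖u‖₁ = ‖(A + I)^(1/2) u‖ = ((A + I) u, u)^(1/2)`. -/
def HMinusOne (A : H →ₗ.[ℂ] H) : Set (A.domain →ₗ⋆[ℂ] ℂ) :=
  {ψ | ∃ C : ℝ, ∀ u : A.domain, ‖ψ u‖ ≤ C * √((inner ℂ (A u + (u : H)) (u : H)).re)}

/-- The continuation `𝔸 : H → ℋ₋₂(A)` of `A`: `⟨𝔸 f, u⟩ = (A u, f)` for `u ∈ D(A)`. -/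
def extOp (A : H →ₗ.[ℂ] H) (f : H) : A.domain →ₗ⋆[ℂ] ℂ where
  toFun u := inner ℂ (A u) f
  map_add' u v := by simp [A.map_add, inner_add_left]
  map_smul' c u := by simp [A.map_smul, inner_smul_left]

/-- `(𝔸 + I)⁻¹ ψ`: the vector `h` with `𝔸 h + h = ψ`. It exists and is unique when `A` is a
nonnegative self-adjoint operator and `ψ ∈ ℋ₋₂(A)`: see `extResolvent_spec`, `extOp_injective`. -/
noncomputable def extResolvent (A : H →ₗ.[ℂ] H) (ψ : A.domain →ₗ⋆[ℂ] ℂ) : H :=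
  Classical.epsilon fun h => extOp A h + embed A h = ψ

/-- The continuation of a unitary operator `V` onto `ℋ₋₂(A)`: the map dual to `V⁻¹ = V*` on `D(A)`,
`⟨𝕍 ψ, u⟩ = ⟨ψ, V* u⟩`. It agrees with `V` on `H`: see `extUnitary_embed`. -/
def extUnitary (A : H →ₗ.[ℂ] H) (V : H ≃ₗᵢ[ℂ] H) (hV : ∀ u ∈ A.domain, V.symm u ∈ A.domain)
    (ψ : A.domain →ₗ⋆[ℂ] ℂ) : A.domain →ₗ⋆[ℂ] ℂ where
  toFun u := ψ ⟨V.symm u, hV u u.2⟩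
  map_add' u v := by
    rw [← map_add]
    congr 1
    ext
    simp
  map_smul' c u := by
    rw [← LinearMap.map_smulₛₗ]
    congr 1
    ext
    simp

theorem extUnitary_embed (A : H →ₗ.[ℂ] H) (V : H ≃ₗᵢ[ℂ] H)
    (hV : ∀ u ∈ A.domain, V.symm u ∈ A.domain) (x : H) :
    extUnitary A V hV (embed A x) = embed A (V x) := by
  ext u
  change inner ℂ (V.symm u) x = inner ℂ (u : H) (V x)
  rw [← V.inner_map_map (V.symm u) x, V.apply_symm_apply]

/-- `ψ` is `ξ(t)`-invariant with respect to `U`: `𝕌_t ψ = ξ(t) ψ` for all `t`. -/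
def IsInvariantElement {T : Set ℝ} (A : H →ₗ.[ℂ] H) (U : T → H ≃ₗᵢ[ℂ] H) (ξ : T → ℝ)
    (ψ : A.domain →ₗ⋆[ℂ] ℂ) : Prop :=
  ∀ t : T, ∃ hV : ∀ u ∈ A.domain, (U t).symm u ∈ A.domain,
    extUnitary A (U t) hV ψ = (ξ t : ℂ) • ψ

/-- The real constant `r` solves
`(ξ(t)² - p(t)) r = ξ(t) (1 - p(t)) (h, U_t h)` for all `t`, where `h = (𝔸 + I)⁻¹ ψ`. -/
def SolvesScalarEquation {T : Set ℝ} (A : H →ₗ.[ℂ] H) (U : T → H ≃ₗᵢ[ℂ] H) (p ξ : T → ℝ)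
    (ψ : A.domain →ₗ⋆[ℂ] ℂ) (r : ℝ) : Prop :=
  ∀ t : T, ((ξ t : ℂ) ^ 2 - (p t : ℂ)) * (r : ℂ) =
    (ξ t : ℂ) * (1 - (p t : ℂ)) *
      inner ℂ (U t (extResolvent A ψ)) (extResolvent A ψ)

/-- The value `⟨ψᵉˣ, u + α h⟩ = ⟨ψ, u⟩ + α r` of the extended functional
(`u ∈ D(A)`, `α ∈ ℂ`, `h = (𝔸 + I)⁻¹ ψ`). -/
noncomputable def extFunctional (A : H →ₗ.[ℂ] H) (ψ : A.domain →ₗ⋆[ℂ] ℂ) (r : ℝ)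
    (u : A.domain) (α : ℂ) : ℂ :=
  conj (ψ u) + α * (r : ℂ)

/-- `f, g ∈ ℋ₁(A)` and `((A + I)^(1/2) f, (A + I)^(1/2) g) = c`, the scalar product of `ℋ₁(A)` being
the continuous extension of `((A + I) u, v)` from `D(A)`. -/
def IsEnergyInner (A : H →ₗ.[ℂ] H) (f g : H) (c : ℂ) : Prop :=
  ∃ a b : ℕ → A.domain, IsFormLimit A a f ∧ IsFormLimit A b g ∧
    Tendsto (fun n => inner ℂ (b n : H) (A (a n) + (a n : H))) atTop (𝓝 c)

/-- The number `r` is admissible for the regularization of `A + b⟨ψ,·⟩ψ`: if `ψ ∈ ℋ₋₁(A)`, then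
`⟨ψᵉˣ, f⟩ = ((A + I)^(1/2) f, (A + I)^(1/2) h)` for all `f ∈ D(A_sym*) ∩ ℋ₁(A)`, where
`D(A_sym*) = {u + α h : u ∈ D(A), α ∈ ℂ}`. -/
def IsAdmissibleNumber (A : H →ₗ.[ℂ] H) (hA : IsNonneg A) (ψ : A.domain →ₗ⋆[ℂ] ℂ) (r : ℝ) :
    Prop :=
  ψ ∈ HMinusOne A → ∀ (u : A.domain) (α : ℂ),
    (u : H) + α • extResolvent A ψ ∈ formDomain A hA →
      IsEnergyInner A ((u : H) + α • extResolvent A ψ) (extResolvent A ψ)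
        (extFunctional A ψ r u α)

/-- The kernel `{u + α h : ⟨ψ, u⟩ + α r = 0}` of the extended functional. -/
def extKer (A : H →ₗ.[ℂ] H) (ψ : A.domain →ₗ⋆[ℂ] ℂ) (r : ℝ) : Submodule ℂ H where
  carrier := {f | ∃ (u : A.domain) (α : ℂ), f = (u : H) + α • extResolvent A ψ ∧
    extFunctional A ψ r u α = 0}
  zero_mem' := ⟨0, 0, by simp, by simp [extFunctional]⟩
  add_mem' := by
    rintro f g ⟨u, α, rfl, hu⟩ ⟨v, β, rfl, hv⟩
    refine ⟨u + v, α + β, ?_, ?_⟩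
    · rw [Submodule.coe_add, add_smul]
      abel
    · simp only [extFunctional, map_add] at hu hv ⊢
      linear_combination hu + hv
  smul_mem' := by
    rintro c f ⟨u, α, rfl, hu⟩
    refine ⟨c • u, c * α, ?_, ?_⟩
    · rw [Submodule.coe_smul, smul_add, mul_smul]
    · simp only [extFunctional, LinearMap.map_smulₛₗ, smul_eq_mul, map_mul,
        Complex.conj_conj] at hu ⊢
      linear_combination c * hu

end General

section Complete

attribute [local instance 10000] InnerProductSpace.toInner

variable {H : Type*} [NormedAddCommGroup H] [InnerProductSpace ℂ H] [CompleteSpace H]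

/-- Every `ψ ∈ ℋ₋₂(A)` is of the form `(𝔸 + I) h`. -/
theorem extResolvent_spec {A : H →ₗ.[ℂ] H} {ψ : A.domain →ₗ⋆[ℂ] ℂ} (hψ : ψ ∈ HMinusTwo A) :
    extOp A (extResolvent A ψ) + embed A (extResolvent A ψ) = ψ := by
  apply Classical.epsilon_spec (p := fun h => extOp A h + embed A h = ψ)
  obtain ⟨C, hC⟩ := hψ
  let L : A.domain →ₗ[ℂ] H := A.toFun + A.domain.subtype
  have hL : ∀ u, L u = A u + (u : H) := fun u => rfl
  have key : ∀ u v, L u = L v → ψ u = ψ v := by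
    intro u v huv
    have h := hC (u - v)
    rw [← hL, L.map_sub, huv, sub_self, norm_zero, mul_zero, norm_le_zero_iff, map_sub] at h
    exact sub_eq_zero.mp h
  choose σ hσ using fun y : LinearMap.range L => y.2
  let φ : LinearMap.range L →ₗ[ℂ] ℂ :=
    { toFun := fun y => conj (ψ (σ y))
      map_add' := fun y z => by
        rw [← map_add, ← map_add]
        exact congrArg _ (key _ _ (by rw [map_add, hσ, hσ, hσ]; rfl))
      map_smul' := fun c y => by
        have h : ψ (σ (c • y)) = ψ (c • σ y) :=
          key _ _ (by rw [map_smul, hσ, hσ]; rfl)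
        rw [h, LinearMap.map_smulₛₗ]
        simp }
  have hφ : ∀ u (hu : L u ∈ LinearMap.range L), φ ⟨L u, hu⟩ = conj (ψ u) :=
    fun u hu => congrArg (starRingEnd ℂ) (key _ _ (hσ _))
  let f : StrongDual ℂ (LinearMap.range L) := φ.mkContinuous C fun y => by
    have h := hC (σ y)
    rw [← hL, hσ] at h
    change ‖conj (ψ (σ y))‖ ≤ _
    rw [RCLike.norm_conj]
    exact h
  obtain ⟨g, hg, -⟩ := exists_extension_norm_eq (LinearMap.range L) f
  refine ⟨(InnerProductSpace.toDual ℂ H).symm g, ?_⟩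
  ext u
  change inner ℂ (A u) _ + inner ℂ (u : H) _ = _
  rw [← inner_add_left, ← inner_conj_symm, InnerProductSpace.toDual_symm_apply, ← hL]
  have h : g (L u) = conj (ψ u) := (hg ⟨L u, u, rfl⟩).trans (hφ u ⟨u, rfl⟩)
  rw [h, Complex.conj_conj]

/-- For a nonnegative self-adjoint `A`, the map `𝔸 + I` is injective on `H`. -/
theorem extOp_injective {A : H →ₗ.[ℂ] H} (hA : IsSelfAdjoint A) (hA' : IsNonneg A) {h k : H}
    (hhk : extOp A h + embed A h = extOp A k + embed A k) : h = k := by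
  have hd := hA.dense_domain
  have h1 : ∀ u : A.domain, inner ℂ (-(h - k)) (u : H) = inner ℂ (h - k) (A u) := by
    intro u
    have h2 := congrArg conj (LinearMap.congr_fun hhk u)
    change conj (inner ℂ (A u) h + inner ℂ (u : H) h)
      = conj (inner ℂ (A u) k + inner ℂ (u : H) k) at h2
    simp only [map_add, inner_conj_symm] at h2
    rw [inner_neg_left, inner_sub_left, inner_sub_left]
    linear_combination -h2
  have h3 : h - k ∈ A.adjoint.domain := LinearPMap.mem_adjoint_domain_of_exists _ ⟨_, h1⟩
  have h4 : A.adjoint ⟨h - k, h3⟩ = -(h - k) := LinearPMap.adjoint_apply_eq hd _ h1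
  have h5 : ∀ B : H →ₗ.[ℂ] H, B = A → ∀ hB : h - k ∈ B.domain, B ⟨h - k, hB⟩ = -(h - k) →
      h - k = 0 := by
    rintro B rfl hB hBe
    have h6 := hA' ⟨h - k, hB⟩
    rw [hBe] at h6
    simp only [inner_neg_left, Complex.neg_re] at h6
    have h7 : (inner ℂ (h - k) (h - k)).re = ‖h - k‖ ^ 2 := inner_self_eq_norm_sq (𝕜 := ℂ) _
    rw [h7] at h6
    exact norm_eq_zero.mp (pow_eq_zero_iff two_ne_zero |>.mp (by nlinarith [sq_nonneg ‖h - k‖]))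
  exact sub_eq_zero.mp (h5 _ (LinearPMap.isSelfAdjoint_def.mp hA) h3 h4)

/-- The Friedrichs extension of a densely defined nonnegative symmetric operator `S`: the
restriction of `S*` to the vectors of `D(S*)` that lie in the domain of the closed form of `S`. -/
noncomputable def friedrichsExtension (S : H →ₗ.[ℂ] H) (hS : IsNonneg S) : H →ₗ.[ℂ] H :=
  S.adjoint.domRestrict (formDomain S hS)

/-- The vectors `f ∈ D(S*)` for which there are `a n ∈ D(S)` with `S (a n) → S* f` and
`(S (a m - a n), a m - a n) → 0`. -/
noncomputable def kreinDomain (S : H →ₗ.[ℂ] H) (hS : IsNonneg S) : Submodule ℂ H where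
  carrier := {f | ∃ (hf : f ∈ S.adjoint.domain) (a : ℕ → S.domain),
    Tendsto (fun n => S (a n)) atTop (𝓝 (S.adjoint ⟨f, hf⟩)) ∧ FormCauchy S a}
  zero_mem' := by
    refine ⟨Submodule.zero_mem _, fun _ => 0, ?_, FormCauchy.zero S⟩
    have h : S.adjoint ⟨0, Submodule.zero_mem _⟩ = 0 := S.adjoint.map_zero
    rw [h]
    simp only [S.map_zero]
    exact tendsto_const_nhds
  add_mem' := by
    rintro f g ⟨hf, a, ha, ha'⟩ ⟨hg, b, hb, hb'⟩
    refine ⟨Submodule.add_mem _ hf hg, fun n => a n + b n, ?_, ha'.add hS hb'⟩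
    have h : S.adjoint ⟨f + g, Submodule.add_mem _ hf hg⟩
        = S.adjoint ⟨f, hf⟩ + S.adjoint ⟨g, hg⟩ := S.adjoint.map_add ⟨f, hf⟩ ⟨g, hg⟩
    rw [h]
    simp only [S.map_add]
    exact ha.add hb
  smul_mem' := by
    rintro c f ⟨hf, a, ha, ha'⟩
    refine ⟨Submodule.smul_mem _ c hf, fun n => c • a n, ?_, ha'.smul c⟩
    have h : S.adjoint ⟨c • f, Submodule.smul_mem _ c hf⟩ = c • S.adjoint ⟨f, hf⟩ :=
      S.adjoint.map_smul c ⟨f, hf⟩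
    rw [h]
    simp only [S.map_smul]
    exact ha.const_smul c

/-- The Krein-von Neumann extension of a densely defined nonnegative symmetric operator `S`, that
is `((S⁻¹)_F)⁻¹`, the inverse of the Friedrichs extension of the inverse (as linear relations). -/
noncomputable def kreinExtension (S : H →ₗ.[ℂ] H) (hS : IsNonneg S) : H →ₗ.[ℂ] H :=
  S.adjoint.domRestrict (kreinDomain S hS)

/-- The Friedrichs extension `A_F` of `A_sym = A ↾ ker ψ`. -/
noncomputable def symFriedrichs (A : H →ₗ.[ℂ] H) (hA : IsNonneg A) (ψ : A.domain →ₗ⋆[ℂ] ℂ) :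
    H →ₗ.[ℂ] H :=
  friedrichsExtension (restrictKer A ψ) (restrictKer_isNonneg hA ψ)

/-- The Krein-von Neumann extension `A_N` of `A_sym = A ↾ ker ψ`. -/
noncomputable def symKrein (A : H →ₗ.[ℂ] H) (hA : IsNonneg A) (ψ : A.domain →ₗ⋆[ℂ] ℂ) :
    H →ₗ.[ℂ] H :=
  kreinExtension (restrictKer A ψ) (restrictKer_isNonneg hA ψ)

/-- `B` is a self-adjoint extension of `S`. -/
def IsSelfAdjointExtension (S B : H →ₗ.[ℂ] H) : Prop :=
  IsSelfAdjoint B ∧ S ≤ B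

/-- The operator `A_sym* ↾ ker ⟨ψᵉˣ, ·⟩` determined by the number `r`. -/
noncomputable def regularizingOperator (A : H →ₗ.[ℂ] H) (ψ : A.domain →ₗ⋆[ℂ] ℂ) (r : ℝ) :
    H →ₗ.[ℂ] H :=
  (restrictKer A ψ).adjoint.domRestrict (extKer A ψ r)

/-- `B` is an admissible operator for the regularization of `A + b⟨ψ,·⟩ψ`. -/
def IsAdmissibleOperator (A : H →ₗ.[ℂ] H) (hA : IsNonneg A) (ψ : A.domain →ₗ⋆[ℂ] ℂ)
    (B : H →ₗ.[ℂ] H) : Prop :=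
  ∃ r : ℝ, IsAdmissibleNumber A hA ψ r ∧ B = regularizingOperator A ψ r

end Complete

end RankOneSymmetry

open RankOneSymmetry

namespace RankOneSymmetry

/-! ### Bounded symmetric operators: ranges, square roots, limit relations. -/

section BoundedOperators

attribute [local instance 10000] InnerProductSpace.toInner

variable {H : Type*} [NormedAddCommGroup H] [InnerProductSpace ℂ H]

/-! Everything is rewritten through the contraction `R = (A₀ + I)⁻¹`, `0 ≤ R ≤ 1`, and the vector
`h`, which lies outside `ran R` because `ψ` is singular. With the coordinate `f + g` for a point
`(f, g)` of a graph, `A₀` is `f = R (f + g)`, the adjoint of `A_sym` is `f = R (f + g) + α h`, and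
`A_sym` is `α = 0`, `⟨h, f + g⟩ = 0` (`inner ℂ h (f + g)`). Thus `α` and `⟨h, f + g⟩` are boundary
values; Green's identity in these terms shows that the self-adjoint extensions are `A₀` (`α = 0`)
and the operators `A_r`: `⟨h, f + g⟩ + α r = 0`, `r` real (`isSelfAdjointExtension_iff`).

The Friedrichs and Krein extensions are governed by `R^(1/2)` and `(1 - R)^(1/2)`. If `h` is outside
the range of the root, the extension is `A₀`; if `h` is the image of `k`, chosen orthogonal to the
kernel of the root, the extension is `A_r` with `r = ‖k‖² > 0` for Friedrichs and `r = -‖k‖² < 0`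
for Krein. Moreover `ψ ∈ ℋ₋₁` means `h ∈ ran R^(1/2)`, and then `‖k‖²` is the only admissible
number.

A homogeneity `U_t` acts linearly on the boundary values (`apply_map_adjoint`), so `A_r` is
homogeneous exactly when `r` solves the scalar equation. Both extremal extensions are homogeneous,
being built canonically from the homogeneous `A_sym`. Hence without a solution both equal `A₀`; with
two solutions the equation degenerates to `0 = 0`.

If `h` is outside both ranges, every `A_r` has a negative eigenvalue
(`exists_negative_eigenvector`), and only one (`negative_eigenvalue_unique`). This settles the case
without solutions. With exactly one solution it excludes `A_F = A_N = A₀`: homogeneity would move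
the eigenvalue `z` of `A_r` to `z / p(t)`, so `p = 1`, `ξ² = 1`, and every real number would be a
solution. The opposite signs of the Friedrichs and Krein parameters exclude that both extensions
differ from `A₀`. -/

theorem re_inner_self (x : H) : (inner ℂ x x).re = ‖x‖ ^ 2 :=
  inner_self_eq_norm_sq (𝕜 := ℂ) x

theorem inner_self_ofReal (x : H) : inner ℂ x x = ((‖x‖ ^ 2 : ℝ) : ℂ) := by
  rw [inner_self_eq_norm_sq_to_K (𝕜 := ℂ) x]
  simp

/-- There are `z n` with `⟨h, z n⟩ = c`, for which `X (z n)` converges to a solution `q` of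
`X q = α h`. -/
def LimitRelation (X : H →L[ℂ] H) (h : H) (c α : ℂ) : Prop :=
  ∃ (z : ℕ → H) (q : H), Tendsto (fun n => X (z n)) atTop (𝓝 q) ∧ X q = α • h ∧
    ∀ n, inner ℂ h (z n) = c

variable [CompleteSpace H]

/-- A vector whose scalar products with `y` are controlled by `‖X y‖` is in the range of the
symmetric operator `X`. -/
theorem exists_apply_eq_of_bound {X : H →L[ℂ] H}
    (hX : ∀ x y, inner ℂ (X x) y = inner ℂ x (X y)) {h : H} {C : ℝ}
    (hC : ∀ y, ‖inner ℂ y h‖ ≤ C * ‖X y‖) : ∃ k, X k = h := by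
  -- With this choice `B + I = X`, so the representation of functionals in `extResolvent_spec`
  -- solves `X k = h`.
  let B : H →ₗ.[ℂ] H := (X - 1 : H →L[ℂ] H).toPMap ⊤
  have hB : ∀ u : B.domain, B u + (u : H) = X u := fun u => by
    change (X - 1 : H →L[ℂ] H) (u : H) + (u : H) = X u
    simp
  have hψ : embed B h ∈ HMinusTwo B := ⟨C, fun u => by
    rw [hB]
    exact hC u⟩
  refine ⟨extResolvent B (embed B h), ext_inner_left ℂ fun v => ?_⟩
  have h1 := LinearMap.congr_fun (extResolvent_spec hψ) (⟨v, trivial⟩ : B.domain)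
  change inner ℂ (B ⟨v, trivial⟩) _ + inner ℂ v _ = inner ℂ v h at h1
  rw [← inner_add_left] at h1
  rw [← hX, ← h1]
  exact congrArg (fun w => inner ℂ w _) (hB ⟨v, trivial⟩).symm

/-- Needed for `(1 - R)^(1/2)`, whose kernel is `ker A₀` and may be nonzero: only the preimage of
`h` orthogonal to it has the norm that gives the Krein parameter. -/
theorem exists_mem_orthogonal_ker (X : H →L[ℂ] H) (k : H) :
    ∃ l ∈ (LinearMap.ker (X : H →ₗ[ℂ] H))ᗮ, X l = X k := by
  obtain ⟨y, hy, z, hz, rfl⟩ :=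
    (LinearMap.ker (X : H →ₗ[ℂ] H)).exists_add_mem_mem_orthogonal k
  refine ⟨z, hz, ?_⟩
  have hy' : X y = 0 := hy
  rw [map_add, hy', zero_add]

/-- When `h ∉ ran X`, the functional `⟨h, ·⟩` is not controlled by `‖X ·‖`, so the constraint `⟨h, z
n⟩ = c` can be met with `X (z n) → 0` and leaves `c` free. -/
theorem limitRelation_iff_of_notMem_range {X : H →L[ℂ] H}
    (hX : ∀ x y, inner ℂ (X x) y = inner ℂ x (X y)) {h : H} (hh : ∀ k, X k ≠ h) (c α : ℂ) :
    LimitRelation X h c α ↔ α = 0 := by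
  constructor
  · rintro ⟨z, q, -, hq, -⟩
    by_contra hα
    refine hh (α⁻¹ • q) ?_
    rw [map_smul, hq, smul_smul, inv_mul_cancel₀ hα, one_smul]
  · rintro rfl
    have h1 : ∀ n : ℕ, ∃ y, ((n : ℝ) + 1) * ‖X y‖ < ‖inner ℂ h y‖ := by
      intro n
      by_contra! hn
      obtain ⟨k, hk⟩ := exists_apply_eq_of_bound hX (h := h) (C := (n : ℝ) + 1)
        fun y => by rw [norm_inner_symm]; exact hn y
      exact hh k hk
    choose y hy using h1
    have hpos : ∀ n, 0 < ‖inner ℂ h (y n)‖ := fun n => lt_of_le_of_lt (by positivity) (hy n)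
    -- Rescaling vectors that violate the bound with constant `n + 1` gives `‖X (z n)‖ ≤ ‖c‖ / (n +
    -- 1)`.
    refine ⟨fun n => (c / inner ℂ h (y n)) • y n, 0, ?_, by simp, fun n => ?_⟩
    · have h2 : Tendsto (fun n : ℕ => ‖c‖ * (1 / ((n : ℝ) + 1))) atTop (𝓝 0) := by
        simpa using tendsto_one_div_add_atTop_nhds_zero_nat.const_mul ‖c‖
      refine squeeze_zero_norm (fun n => ?_) h2
      rw [map_smul, norm_smul, norm_div, div_mul_eq_mul_div, mul_div_assoc]
      refine mul_le_mul_of_nonneg_left ?_ (norm_nonneg _)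
      rw [div_le_div_iff₀ (hpos n) (by positivity)]
      linarith [hy n]
    · rw [inner_smul_right, div_mul_cancel₀ _ (norm_pos_iff.mp (hpos n))]

/-- Here `⟨h, z n⟩ = ⟨k, X (z n)⟩` tends to `⟨k, q⟩`, and `q` is orthogonal to `ker X` as a limit of
values of `X`; so `X q = α h` forces `q = α k`. -/
theorem limitRelation_iff_of_apply_eq {X : H →L[ℂ] H}
    (hX : ∀ x y, inner ℂ (X x) y = inner ℂ x (X y)) {h k : H} (hh : h ≠ 0) (hk : X k = h)
    (hk' : k ∈ (LinearMap.ker (X : H →ₗ[ℂ] H))ᗮ) (c α : ℂ) :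
    LimitRelation X h c α ↔ c = α * ((‖k‖ ^ 2 : ℝ) : ℂ) := by
  constructor
  · rintro ⟨z, q, hz, hq, hc⟩
    have h1 : inner ℂ k q = c := by
      refine tendsto_nhds_unique (tendsto_const_nhds.inner hz) ?_
      simp only [← hX, hk, hc]
      exact tendsto_const_nhds
    have h2 : q ∈ (LinearMap.ker (X : H →ₗ[ℂ] H))ᗮ := by
      intro v hv
      have hv' : X v = 0 := hv
      refine tendsto_nhds_unique (tendsto_const_nhds.inner hz) ?_
      simp only [← hX, hv', inner_zero_left]
      exact tendsto_const_nhds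
    have h3 : q - α • k ∈ LinearMap.ker (X : H →ₗ[ℂ] H) := by
      change X (q - α • k) = 0
      rw [map_sub, map_smul, hq, hk, sub_self]
    have h4 := Submodule.sub_mem _ h2 (Submodule.smul_mem _ α hk')
    have h5 : q - α • k = 0 := inner_self_eq_zero.mp (h4 _ h3)
    rw [← h1, sub_eq_zero.mp h5, inner_smul_right, inner_self_ofReal]
  · rintro rfl
    have hadj : ContinuousLinearMap.adjoint X = X :=
      (ContinuousLinearMap.eq_adjoint_iff X X).mpr hX |>.symm
    have h1 : α • k ∈ closure (Set.range X) := by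
      have h2 := Submodule.smul_mem _ α hk'
      rw [ContinuousLinearMap.orthogonal_ker, hadj] at h2
      exact h2
    obtain ⟨w, hw, hw'⟩ := mem_closure_iff_seq_limit.mp h1
    choose y hy using hw
    obtain rfl : (fun n => X (y n)) = w := funext hy
    have hh' : inner ℂ h h ≠ 0 := inner_self_ne_zero.mpr hh
    set c := α * ((‖k‖ ^ 2 : ℝ) : ℂ) with hc
    have h3 : Tendsto (fun n => inner ℂ h (y n)) atTop (𝓝 c) := by
      have h4 := (tendsto_const_nhds (x := k)).inner (𝕜 := ℂ) hw'
      rw [inner_smul_right, inner_self_ofReal] at h4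
      simpa only [← hX, hk] using h4
    -- A vanishing correction along `h` turns `⟨h, y n⟩ → c` into the exact constraint.
    refine ⟨fun n => y n + ((c - inner ℂ h (y n)) / inner ℂ h h) • h, α • k, ?_, ?_, fun n => ?_⟩
    · simp only [map_add, map_smul]
      have h5 : Tendsto (fun n => ((c - inner ℂ h (y n)) / inner ℂ h h) • X h) atTop (𝓝 0) := by
        have h6 := ((h3.const_sub c).div_const (inner ℂ h h)).smul_const (X h)
        simpa using h6
      simpa using hw'.add h5
    · rw [map_smul, hk]
    · rw [inner_add_right, inner_smul_right, div_mul_cancel₀ _ hh']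
      ring

theorem exists_symmetric_sqrt {Z : H →L[ℂ] H} (hZ : ∀ x y, inner ℂ (Z x) y = inner ℂ x (Z y))
    (hZ' : ∀ x, 0 ≤ (inner ℂ (Z x) x).re) :
    ∃ X : H →L[ℂ] H, (∀ x y, inner ℂ (X x) y = inner ℂ x (X y)) ∧ ∀ x, X (X x) = Z x := by
  have h1 : (0 : H →L[ℂ] H) ≤ Z := by
    rw [ContinuousLinearMap.nonneg_iff_isPositive]
    exact ⟨hZ, hZ'⟩
  have h2 := (ContinuousLinearMap.nonneg_iff_isPositive _).mp (CFC.sqrt_nonneg Z)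
  refine ⟨CFC.sqrt Z, h2.1, fun x => ?_⟩
  exact congrArg (fun F : H →L[ℂ] H => F x) (CFC.sqrt_mul_sqrt_self Z h1)

/-- Cauchy–Schwarz for the nonnegative form of `Z`, via its square root. -/
theorem norm_inner_apply_sq_le {Z : H →L[ℂ] H}
    (hZ : ∀ x y, inner ℂ (Z x) y = inner ℂ x (Z y))
    (hZ' : ∀ x, 0 ≤ (inner ℂ (Z x) x).re) (x y : H) :
    ‖inner ℂ y (Z x)‖ ^ 2 ≤ (inner ℂ (Z y) y).re * (inner ℂ (Z x) x).re := by
  obtain ⟨X, hX, hXX⟩ := exists_symmetric_sqrt hZ hZ'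
  have h1 : ∀ v, (inner ℂ (Z v) v).re = ‖X v‖ ^ 2 := fun v => by
    rw [← hXX, hX, re_inner_self]
  rw [h1, h1, ← hXX, ← hX, ← mul_pow]
  gcongr
  exact norm_inner_le_norm _ _

/-- Approximation by vectors `Z (y n)`, `y n ⟂ h`, in the norm of `H` and of the form
`‖X y‖² - ‖Z y‖²`, where `X² = Z`. -/
theorem exists_seq_iff_limitRelation {X Z : H →L[ℂ] H} (hXX : ∀ y, X (X y) = Z y) {φ : H → ℝ}
    (hφ : ∀ y, 0 ≤ φ y) (hφX : ∀ y, ‖X y‖ ^ 2 = ‖Z y‖ ^ 2 + φ y) {h e m : H} {α : ℂ}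
    (hm : m = Z e + α • h) :
    (∃ y : ℕ → H, (∀ n, inner ℂ h (y n) = 0) ∧ Tendsto (fun n => Z (y n)) atTop (𝓝 m) ∧
      Tendsto (fun k : ℕ × ℕ => φ (y k.1 - y k.2)) atTop (𝓝 0)) ↔
      LimitRelation X h (-inner ℂ h e) α := by
  constructor
  · rintro ⟨y, hy, hym, hyφ⟩
    have h1 : CauchySeq fun n => X (y n) := by
      rw [cauchySeq_iff_tendsto_dist_atTop_0]
      have h2 := (cauchySeq_iff_tendsto_dist_atTop_0.mp hym.cauchySeq).pow 2
      have h3 := (h2.add hyφ).sqrt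
      refine Tendsto.congr (fun k => ?_) (by simpa using h3)
      rw [dist_eq_norm, dist_eq_norm, ← map_sub, ← map_sub, ← hφX, Real.sqrt_sq (norm_nonneg _)]
    obtain ⟨l, hl⟩ := cauchySeq_tendsto_of_complete h1
    have h4 : X l = m := by
      refine tendsto_nhds_unique ((X.continuous.tendsto l).comp hl) (Tendsto.congr (fun n => ?_) hym)
      exact (hXX _).symm
    -- The form norm of `Z (y n)` is `‖X (y n)‖`, so `X (y n)` converges. Shifting by `e` turns `X l
    -- = m = Z e + α h` into `X q = α h`.
    refine ⟨fun n => y n - e, l - X e, ?_, ?_, fun n => ?_⟩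
    · simpa only [map_sub] using hl.sub_const (X e)
    · rw [map_sub, hXX, h4, hm, add_sub_cancel_left]
    · rw [inner_sub_right, hy, zero_sub]
  · rintro ⟨z, q, hz, hq, hc⟩
    have h1 : Tendsto (fun n => X (z n + e)) atTop (𝓝 (q + X e)) := by
      simpa only [map_add] using hz.add_const (X e)
    refine ⟨fun n => z n + e, fun n => ?_, ?_, ?_⟩
    · rw [inner_add_right, hc, neg_add_cancel]
    · have h2 := (X.continuous.tendsto _).comp h1
      rw [map_add, hq, hXX, add_comm, ← hm] at h2
      exact Tendsto.congr (fun n => hXX _) h2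
    · have h2 := (cauchySeq_iff_tendsto_dist_atTop_0.mp h1.cauchySeq).pow 2
      rw [zero_pow two_ne_zero] at h2
      refine squeeze_zero (fun k => hφ _) (fun k => ?_) h2
      rw [dist_eq_norm, ← map_sub, hφX]
      exact le_add_of_nonneg_left (sq_nonneg _)

end BoundedOperators

/-! ### The function `s ↦ s ⟨h, (1 - s R)⁻¹ h⟩`, which locates negative eigenvalues. -/

section NegativeSpectrum

attribute [local instance 10000] InnerProductSpace.toInner

variable {H : Type*} [NormedAddCommGroup H] [InnerProductSpace ℂ H]

theorem norm_sq_le_re_inner_apply {R : H →L[ℂ] H} (hW : ∀ x, 0 ≤ (inner ℂ (x - R x) (R x)).re)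
    (x : H) : ‖R x‖ ^ 2 ≤ (inner ℂ (R x) x).re := by
  have h1 := hW x
  have h2 := inner_re_symm (𝕜 := ℂ) x (R x)
  rw [RCLike.re_eq_complex_re] at h2
  rw [inner_sub_left, Complex.sub_re, re_inner_self] at h1
  linarith

theorem re_inner_apply_le_norm_sq {R : H →L[ℂ] H} (hW : ∀ x, 0 ≤ (inner ℂ (x - R x) (R x)).re)
    (x : H) : (inner ℂ (R x) x).re ≤ ‖x‖ ^ 2 := by
  have h1 := hW x
  have h2 := re_inner_self (x - R x)
  have h3 : inner ℂ (x - R x) x = inner ℂ (x - R x) (x - R x) + inner ℂ (x - R x) (R x) := by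
    rw [← inner_add_right, sub_add_cancel]
  have h4 := congrArg Complex.re h3
  rw [Complex.add_re, h2, inner_sub_left, Complex.sub_re, re_inner_self] at h4
  have h5 := sq_nonneg ‖x - R x‖
  linarith

theorem re_inner_sub_smul_apply (R : H →L[ℂ] H) (s : ℝ) (x : H) :
    (inner ℂ ((1 - (s : ℂ) • R) x) x).re = ‖x‖ ^ 2 - s * (inner ℂ (R x) x).re := by
  simp only [sub_apply, one_apply_eq_self, smul_apply,
    inner_sub_left, inner_smul_left, Complex.sub_re, Complex.conj_ofReal, Complex.re_ofReal_mul,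
    re_inner_self]

/-- Since `0 ≤ R ≤ 1`, the form of `1 - s R` lies above the smaller of its values at the ends of
`[0, 1]`; for `s < 1` this makes the operator coercive, hence invertible. -/
theorem min_mul_norm_sq_le {R : H →L[ℂ] H} (hW : ∀ x, 0 ≤ (inner ℂ (x - R x) (R x)).re)
    (s : ℝ) (x : H) :
    min 1 (1 - s) * ‖x‖ ^ 2 ≤ (inner ℂ ((1 - (s : ℂ) • R) x) x).re := by
  rw [re_inner_sub_smul_apply]
  have h1 := (sq_nonneg _).trans (norm_sq_le_re_inner_apply hW x)
  have h2 := re_inner_apply_le_norm_sq hW x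
  have h3 := sq_nonneg ‖x‖
  rcases le_total s 0 with hs | hs
  · rw [min_eq_left (by linarith)]
    nlinarith
  · rw [min_eq_right (by linarith)]
    nlinarith

variable [CompleteSpace H]

theorem isUnit_one_sub_smul {R : H →L[ℂ] H} (hW : ∀ x, 0 ≤ (inner ℂ (x - R x) (R x)).re)
    {s : ℝ} (hs : s < 1) : IsUnit (1 - (s : ℂ) • R) := by
  have hc : 0 < min 1 (1 - s) := lt_min one_pos (by linarith)
  refine ContinuousLinearMap.isUnit_of_forall_le_norm_inner_map _ (c := ⟨_, hc.le⟩) hc fun x => ?_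
  rw [mul_comm]
  exact (min_mul_norm_sq_le hW s x).trans (Complex.re_le_norm _)

theorem inverse_one_sub_smul_apply {R : H →L[ℂ] H}
    (hW : ∀ x, 0 ≤ (inner ℂ (x - R x) (R x)).re) {s : ℝ} (hs : s < 1) (h : H) :
    (1 - (s : ℂ) • R) (Ring.inverse (1 - (s : ℂ) • R) h) = h :=
  congrArg (fun F : H →L[ℂ] H => F h) (Ring.mul_inverse_cancel _ (isUnit_one_sub_smul hW hs))

/-- For a nonnegative contraction `R` and `h` outside of the ranges of `R^(1/2)` and
`(1 - R)^(1/2)`, the function `s ↦ s ⟨h, (1 - s R)⁻¹ h⟩` maps `(-∞, 1)` onto `ℝ`. -/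
theorem exists_sub_smul_apply_eq {R T V : H →L[ℂ] H}
    (hR : ∀ x y, inner ℂ (R x) y = inner ℂ x (R y))
    (hW : ∀ x, 0 ≤ (inner ℂ (x - R x) (R x)).re)
    (hT : ∀ x y, inner ℂ (T x) y = inner ℂ x (T y)) (hTT : ∀ x, T (T x) = R x)
    (hV : ∀ x y, inner ℂ (V x) y = inner ℂ x (V y)) (hVV : ∀ x, V (V x) = x - R x)
    {h : H} (hTh : ∀ k, T k ≠ h) (hVh : ∀ k, V k ≠ h) (r : ℝ) :
    ∃ s : ℝ, s < 1 ∧ ∃ f : H, f - (s : ℂ) • R f = h ∧ s * (inner ℂ h f).re = r := by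
  set F : ℝ → H := fun s => Ring.inverse (1 - (s : ℂ) • R) h with hF
  have hGF : ∀ s : ℝ, s < 1 → (1 - (s : ℂ) • R) (F s) = h := fun s hs =>
    inverse_one_sub_smul_apply hW hs h
  set Q : ℝ → ℝ := fun s => s * (inner ℂ h (F s)).re with hQ
  have hcont : ContinuousOn Q (Set.Iio 1) := by
    intro s hs
    have h1 : ContinuousAt Ring.inverse (1 - (s : ℂ) • R) := by
      obtain ⟨u, hu⟩ := isUnit_one_sub_smul hW (Set.mem_Iio.mp hs)
      rw [← hu]
      exact NormedRing.inverse_continuousAt u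
    have h2 : ContinuousAt (fun s : ℝ => 1 - (s : ℂ) • R) s := by fun_prop
    have h3 : ContinuousAt (fun s : ℝ => Ring.inverse (1 - (s : ℂ) • R)) s :=
      ContinuousAt.comp (f := fun s : ℝ => 1 - (s : ℂ) • R) h1 h2
    have h4 : ContinuousAt F s := h3.clm_apply continuousAt_const
    have h5 : ContinuousAt Q s :=
      continuousAt_id.mul (Complex.continuous_re.continuousAt.comp
        (continuousAt_const.inner (𝕜 := ℂ) h4))
    exact h5.continuousWithinAt
  -- Cauchy–Schwarz for the form of `1 - s R`, applied to `y` and `F s`, where `(1 - s R) (F s) =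
  -- h`.
  have key : ∀ s : ℝ, s < 1 → ∀ y, ‖inner ℂ y h‖ ^ 2 ≤
      (‖y‖ ^ 2 - s * ‖T y‖ ^ 2) * (inner ℂ h (F s)).re := by
    intro s hs y
    have hG : ∀ x y, inner ℂ ((1 - (s : ℂ) • R) x) y = inner ℂ x ((1 - (s : ℂ) • R) y) := by
      intro x y
      simp only [sub_apply, one_apply_eq_self, smul_apply, inner_sub_left, inner_sub_right,
        inner_smul_left, inner_smul_right, Complex.conj_ofReal, hR]
    have h1 := norm_inner_apply_sq_le hG (fun x => (mul_nonneg
      (le_min zero_le_one (by linarith)) (sq_nonneg _)).trans (min_mul_norm_sq_le hW s x)) (F s) y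
    rw [hGF s hs, re_inner_sub_smul_apply, ← hTT, hT, re_inner_self] at h1
    exact h1
  have hTsq : ∀ y, ‖T y‖ ^ 2 = (inner ℂ (R y) y).re := fun y => by
    rw [← hTT, hT, re_inner_self]
  have hVsq : ∀ y, ‖V y‖ ^ 2 = ‖y‖ ^ 2 - ‖T y‖ ^ 2 := fun y => by
    rw [hTsq, ← re_inner_self, hV, hVV, inner_sub_right, Complex.sub_re, re_inner_self, hR]
  have hbound : ∀ {X : H →L[ℂ] H}, (∀ x y, inner ℂ (X x) y = inner ℂ x (X y)) →
      (∀ k, X k ≠ h) → ∀ M, ∃ y, M * ‖X y‖ ^ 2 < ‖inner ℂ y h‖ ^ 2 := by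
    intro X hX hXh M
    by_contra! hcon
    obtain ⟨k, hk⟩ := exists_apply_eq_of_bound hX (h := h) (C := √M) fun y => by
      have h1 := Real.sqrt_le_sqrt (hcon y)
      rwa [Real.sqrt_sq (norm_nonneg _), Real.sqrt_mul' _ (sq_nonneg _),
        Real.sqrt_sq (norm_nonneg _)] at h1
    exact hXh k hk
  -- If `Q < r` throughout, letting `s → 1` in `key` bounds `|⟨y, h⟩|²` by `|r| ‖V y‖²`, which would
  -- put `h` in `ran V`.
  have hup : ∃ s ∈ Set.Iio (1 : ℝ), r ≤ Q s := by
    by_contra! hcon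
    obtain ⟨y, hy⟩ := hbound hV hVh |r|
    refine not_le_of_gt hy ?_
    have h1 : ∀ s ∈ Set.Ioo (0 : ℝ) 1,
        s * ‖inner ℂ y h‖ ^ 2 ≤ |r| * (‖y‖ ^ 2 - s * ‖T y‖ ^ 2) := by
      intro s hs
      have h2 := mul_le_mul_of_nonneg_left (key s hs.2 y) hs.1.le
      have h3 := (hcon s hs.2).le.trans (le_abs_self r)
      have h4 : 0 ≤ ‖y‖ ^ 2 - s * ‖T y‖ ^ 2 := by
        have h5 := re_inner_apply_le_norm_sq hW y
        rw [← hTsq] at h5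
        nlinarith [hs.1, hs.2, sq_nonneg ‖T y‖]
      have h6 := mul_le_mul_of_nonneg_right h3 h4
      simp only [hQ] at h6
      linarith
    have h2 : (1 : ℝ) ∈ closure (Set.Ioo 0 1) := by
      rw [closure_Ioo zero_ne_one]
      exact ⟨zero_le_one, le_rfl⟩
    have h3 := le_on_closure h1 (by fun_prop) (by fun_prop) h2
    rw [hVsq]
    simpa using h3
  -- If `Q > r` throughout, taking `s = -n` in `key` and dividing by `n → ∞` bounds `|⟨y, h⟩|²` by
  -- `|r| ‖T y‖²`, which would put `h` in `ran T`.
  have hdown : ∃ s ∈ Set.Iio (1 : ℝ), Q s ≤ r := by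
    by_contra! hcon
    obtain ⟨y, hy⟩ := hbound hT hTh |r|
    refine not_le_of_gt hy ?_
    have h1 : ∀ n : ℕ, (n : ℝ) * (‖inner ℂ y h‖ ^ 2 - |r| * ‖T y‖ ^ 2) ≤ |r| * ‖y‖ ^ 2 := by
      intro n
      have hn : (0 : ℝ) ≤ n := n.cast_nonneg
      have h2 := mul_le_mul_of_nonneg_left (key (-n) (by linarith) y) hn
      have h3 := (hcon (-n) (Set.mem_Iio.mpr (by linarith))).le
      simp only [hQ] at h3
      have h4 : (n : ℝ) * (inner ℂ h (F (-n))).re ≤ |r| := by linarith [neg_abs_le r]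
      have h6 := mul_le_mul_of_nonneg_right h4
        (show 0 ≤ ‖y‖ ^ 2 + n * ‖T y‖ ^ 2 by positivity)
      linarith
    by_contra! hlt
    obtain ⟨n, hn⟩ := exists_nat_gt (|r| * ‖y‖ ^ 2 / (‖inner ℂ y h‖ ^ 2 - |r| * ‖T y‖ ^ 2))
    rw [div_lt_iff₀ (by linarith)] at hn
    linarith [h1 n]
  obtain ⟨s₁, hs₁, hQ₁⟩ := hdown
  obtain ⟨s₂, hs₂, hQ₂⟩ := hup
  obtain ⟨s, hs, hQs⟩ := isPreconnected_Iio.intermediate_value hs₁ hs₂ hcont ⟨hQ₁, hQ₂⟩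
  refine ⟨s, hs, F s, ?_, hQs⟩
  simpa using hGF s hs

end NegativeSpectrum

/-! ### The resolvent `R` and the graphs of `A_sym`, its adjoint and the operators `A_r`. -/

section Resolvent

attribute [local instance 10000] InnerProductSpace.toInner

variable {H : Type*} [NormedAddCommGroup H] [InnerProductSpace ℂ H]

theorem mem_graph_domRestrict {B : H →ₗ.[ℂ] H} {N : Submodule ℂ H} {f g : H} :
    (f, g) ∈ (B.domRestrict N).graph ↔ f ∈ N ∧ (f, g) ∈ B.graph := by
  simp only [LinearPMap.mem_graph_iff]
  constructor
  · rintro ⟨y, rfl, rfl⟩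
    exact ⟨y.2.1, ⟨y, y.2.2⟩, rfl, (LinearPMap.domRestrict_apply rfl).symm⟩
  · rintro ⟨hN, y, rfl, rfl⟩
    exact ⟨⟨y, hN, y.2⟩, rfl, LinearPMap.domRestrict_apply rfl⟩

theorem exists_eq_smul_of_inner_eq_zero {h m : H} (hh : h ≠ 0)
    (hm : ∀ w, inner ℂ h w = 0 → inner ℂ w m = 0) : ∃ c : ℂ, m = c • h := by
  have h0 : inner ℂ h h ≠ 0 := inner_self_ne_zero.mpr hh
  refine ⟨inner ℂ h m / inner ℂ h h, ?_⟩
  set c := inner ℂ h m / inner ℂ h h with hc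
  have h3 : inner ℂ h (m - c • h) = 0 := by
    rw [inner_sub_right, inner_smul_right, hc, div_mul_cancel₀ _ h0, sub_self]
  rw [← sub_eq_zero, ← inner_self_eq_zero (𝕜 := ℂ), inner_sub_right, hm _ h3, inner_smul_right,
    ← inner_conj_symm, h3, map_zero, mul_zero, sub_self]

/-- `R = (A + I)⁻¹` for the nonnegative self-adjoint operator `A`. -/
structure IsResolvent (A : H →ₗ.[ℂ] H) (R : H →L[ℂ] H) : Prop where
  symm : ∀ x y, inner ℂ (R x) y = inner ℂ x (R y)
  nonneg : ∀ x, 0 ≤ (inner ℂ (x - R x) (R x)).re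
  mem_graph_iff : ∀ {f g : H}, (f, g) ∈ A.graph ↔ R (f + g) = f

namespace IsResolvent

variable {A : H →ₗ.[ℂ] H} {R : H →L[ℂ] H} (hR : IsResolvent A R)

include hR

theorem apply_domain (u : A.domain) : R (u + A u) = u :=
  hR.mem_graph_iff.mp (A.mem_graph u)

theorem apply_mem_graph (y : H) : (R y, y - R y) ∈ A.graph := by
  rw [hR.mem_graph_iff, add_sub_cancel]

theorem apply_mem_domain (y : H) : R y ∈ A.domain :=
  LinearPMap.mem_domain_of_mem_graph (hR.apply_mem_graph y)

theorem apply_apply (y : H) : A ⟨R y, hR.apply_mem_domain y⟩ = y - R y :=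
  ((LinearPMap.image_iff _).mpr (hR.apply_mem_graph y)).symm

theorem eq_zero_of_apply_eq_zero {x : H} (hx : R x = 0) : x = 0 :=
  A.graph_fst_eq_zero_snd (hR.mem_graph_iff.mpr (show R (0 + x) = 0 by rwa [zero_add])) rfl

end IsResolvent

variable [CompleteSpace H]

/-- Nonnegativity gives `‖u‖ ≤ ‖(A + I) u‖`, hence injectivity and the bound. For surjectivity,
`extResolvent` solves `(A + I) k = x` weakly, and self-adjointness puts `k` in the domain. -/
theorem exists_isResolvent {A : H →ₗ.[ℂ] H} (hA : IsSelfAdjoint A) (hA' : IsNonneg A) :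
    ∃ R : H →L[ℂ] H, IsResolvent A R := by
  have hle : ∀ u : A.domain, ‖(u : H)‖ ≤ ‖A u + (u : H)‖ := by
    intro u
    have h1 := hA' u
    have h2 : (inner ℂ (A u + (u : H)) (u : H)).re ≤ ‖A u + (u : H)‖ * ‖(u : H)‖ :=
      (Complex.re_le_norm _).trans (norm_inner_le_norm _ _)
    rw [inner_add_left, Complex.add_re, re_inner_self] at h2
    rcases (norm_nonneg (u : H)).eq_or_lt with h3 | h3
    · rw [← h3]
      exact norm_nonneg _
    · exact le_of_mul_le_mul_right (by linarith [sq ‖(u : H)‖]) h3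
  have hinj : ∀ u v : A.domain, A u + (u : H) = A v + (v : H) → u = v := by
    intro u v huv
    have h1 := hle (u - v)
    have h2 : A (u - v) + ((u - v : A.domain) : H) = 0 := by
      rw [A.map_sub, Submodule.coe_sub, ← sub_eq_zero.mpr huv]
      abel
    rw [h2, norm_zero, norm_le_zero_iff, Submodule.coe_sub, sub_eq_zero] at h1
    exact Subtype.ext h1
  have hsurj : ∀ x, ∃ u : A.domain, A u + (u : H) = x := by
    intro x
    have hx : embed A x ∈ HMinusTwo A := ⟨‖x‖, fun u => by
      change ‖inner ℂ (u : H) x‖ ≤ _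
      rw [mul_comm]
      exact (norm_inner_le_norm _ _).trans (mul_le_mul_of_nonneg_right (hle u) (norm_nonneg _))⟩
    have h1 := extResolvent_spec hx
    set k := extResolvent A (embed A x)
    have h2 : (k, x - k) ∈ A.adjoint.graph := by
      rw [LinearPMap.adjoint_graph_eq_graph_adjoint hA.dense_domain, Submodule.mem_adjoint_iff]
      intro a b hab
      obtain ⟨u, rfl, rfl⟩ := (LinearPMap.mem_graph_iff _).mp hab
      have h3 := LinearMap.congr_fun h1 u
      change inner ℂ (A u) k + inner ℂ (u : H) k = inner ℂ (u : H) x at h3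
      change inner ℂ (A u) k - inner ℂ (u : H) (x - k) = 0
      rw [inner_sub_right]
      linear_combination h3
    rw [LinearPMap.isSelfAdjoint_def.mp hA] at h2
    obtain ⟨u, hu, hu'⟩ := (LinearPMap.mem_graph_iff _).mp h2
    exact ⟨u, by rw [hu, hu']; exact sub_add_cancel _ _⟩
  choose G hG using hsurj
  let R₀ : H →ₗ[ℂ] H :=
    { toFun := fun x => G x
      map_add' := fun x y => by
        rw [← Submodule.coe_add]
        refine congrArg _ (hinj _ _ ?_)
        rw [hG, A.map_add, Submodule.coe_add, add_add_add_comm, hG, hG]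
      map_smul' := fun c x => by
        rw [RingHom.id_apply, ← Submodule.coe_smul]
        refine congrArg _ (hinj _ _ ?_)
        rw [hG, A.map_smul, Submodule.coe_smul, ← smul_add, hG] }
  let R : H →L[ℂ] H := R₀.mkContinuous 1 fun x => by
    rw [one_mul]
    change ‖(G x : H)‖ ≤ ‖x‖
    have h1 := hle (G x)
    rwa [hG] at h1
  have hRG : ∀ x, R x = G x := fun x => rfl
  have hsub : ∀ x, x - R x = A (G x) := fun x => by
    rw [hRG, sub_eq_iff_eq_add, hG]
  refine ⟨R, fun x y => ?_, fun x => ?_, fun {f g} => ⟨fun hfg => ?_, fun hfg => ?_⟩⟩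
  · have h1 : (R y, A (G y)) ∈ A.adjoint.graph := by
      rw [LinearPMap.isSelfAdjoint_def.mp hA]
      exact A.mem_graph _
    rw [LinearPMap.adjoint_graph_eq_graph_adjoint hA.dense_domain, Submodule.mem_adjoint_iff] at h1
    have h2 := h1 _ _ (A.mem_graph (G x))
    simp only [← hsub, ← hRG] at h2
    rw [inner_sub_left, inner_sub_right] at h2
    linear_combination -h2
  · rw [hsub, hRG]
    exact hA' _
  · obtain ⟨u, rfl, rfl⟩ := (LinearPMap.mem_graph_iff _).mp hfg
    change R ((u : H) + A u) = (u : H)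
    rw [hRG]
    exact congrArg _ (hinj _ _ (by rw [hG, add_comm]))
  · rw [LinearPMap.mem_graph_iff]
    refine ⟨G (f + g), hfg, ?_⟩
    rw [← hsub, hfg]
    exact add_sub_cancel_left _ _

theorem apply_eq_inner_extResolvent {A : H →ₗ.[ℂ] H} {ψ : A.domain →ₗ⋆[ℂ] ℂ}
    (hψ : ψ ∈ HMinusTwo A) (u : A.domain) :
    ψ u = inner ℂ ((u : H) + A u) (extResolvent A ψ) := by
  have h1 := LinearMap.congr_fun (extResolvent_spec hψ) u
  rw [← h1, add_comm, inner_add_left]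
  rfl

namespace IsResolvent

variable {A : H →ₗ.[ℂ] H} {R : H →L[ℂ] H} (hR : IsResolvent A R) {ψ : A.domain →ₗ⋆[ℂ] ℂ}
  (hψ : ψ ∈ HMinusTwo A) (hψ' : ψ ∉ Set.range (embed A))

include hR hψ

theorem functional_apply (y : H) :
    ψ ⟨R y, hR.apply_mem_domain y⟩ = inner ℂ y (extResolvent A ψ) := by
  rw [apply_eq_inner_extResolvent hψ, hR.apply_apply]
  change inner ℂ (R y + (y - R y)) _ = _
  rw [add_sub_cancel]

theorem mem_graph_restrictKer {f g : H} :
    (f, g) ∈ (restrictKer A ψ).graph ↔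
      R (f + g) = f ∧ inner ℂ (extResolvent A ψ) (f + g) = 0 := by
  rw [restrictKer, mem_graph_domRestrict, and_comm, ← hR.mem_graph_iff]
  refine and_congr_right fun hfg => ?_
  obtain ⟨u, rfl, rfl⟩ := (LinearPMap.mem_graph_iff _).mp hfg
  rw [← inner_eq_zero_symm]
  change _ ↔ inner ℂ ((u : H) + A u) _ = 0
  rw [← apply_eq_inner_extResolvent hψ]
  simp

include hψ'

theorem extResolvent_notMem_range (k : H) : R k ≠ extResolvent A ψ := by
  intro hk
  refine hψ' ⟨k, ?_⟩
  ext u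
  rw [apply_eq_inner_extResolvent hψ, ← hk, ← hR.symm, hR.apply_domain]
  rfl

theorem extResolvent_ne_zero : extResolvent A ψ ≠ 0 := fun h =>
  hR.extResolvent_notMem_range hψ hψ' 0 (by rw [h, map_zero])

/-- Since `h ∉ ran R` and `R` is injective, the boundary value `α` is well defined on the adjoint's
domain. -/
theorem smul_extResolvent_injective {x y : H} {α β : ℂ}
    (h : R x + α • extResolvent A ψ = R y + β • extResolvent A ψ) : x = y ∧ α = β := by
  have h1 : α = β := by
    by_contra hαβ
    refine hR.extResolvent_notMem_range hψ hψ' ((α - β)⁻¹ • (y - x)) ?_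
    have h2 : R (y - x) = (α - β) • extResolvent A ψ := by
      rw [map_sub, sub_smul, sub_eq_sub_iff_add_eq_add, ← h]
      abel
    rw [map_smul, h2, smul_smul, inv_mul_cancel₀ (sub_ne_zero.mpr hαβ), one_smul]
  refine ⟨sub_eq_zero.mp (hR.eq_zero_of_apply_eq_zero ?_), h1⟩
  rw [h1] at h
  rw [map_sub, add_right_cancel h, sub_self]

/-- A vector `v` orthogonal to the domain `R (h^⊥)` has `R v ⟂ h^⊥`, so `R v` is a multiple of `h`;
as `h ∉ ran R`, this multiple is zero. -/
theorem dense_restrictKer : Dense ((restrictKer A ψ).domain : Set H) := by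
  rw [Submodule.dense_iff_topologicalClosure_eq_top, Submodule.topologicalClosure_eq_top_iff,
    Submodule.eq_bot_iff]
  intro v hv
  have hh := hR.extResolvent_ne_zero hψ hψ'
  have h1 : ∀ w, inner ℂ (extResolvent A ψ) w = 0 → inner ℂ w (R v) = 0 := by
    intro w hw
    rw [← hR.symm]
    refine hv _ (LinearPMap.mem_domain_of_mem_graph
      ((hR.mem_graph_restrictKer hψ (f := R w) (g := w - R w)).mpr ?_))
    rw [add_sub_cancel]
    exact ⟨rfl, hw⟩
  obtain ⟨c, hc⟩ := exists_eq_smul_of_inner_eq_zero hh h1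
  set h := extResolvent A ψ
  have h4 : R v + (0 : ℂ) • h = R 0 + c • h := by
    rw [zero_smul, add_zero, map_zero, zero_add, hc]
  exact (hR.smul_extResolvent_injective hψ hψ' h4).1

/-- Tested against `(R w, w - R w)` with `w ⟂ h`, the adjoint relation says that `f - R (f + g)` is
orthogonal to `h^⊥`, that is, a multiple of `h`. -/
theorem mem_graph_adjoint {f g : H} :
    (f, g) ∈ (restrictKer A ψ).adjoint.graph ↔
      ∃ α : ℂ, f = R (f + g) + α • extResolvent A ψ := by
  have h0 := hR.extResolvent_ne_zero hψ hψ'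
  rw [LinearPMap.adjoint_graph_eq_graph_adjoint (hR.dense_restrictKer hψ hψ'),
    Submodule.mem_adjoint_iff]
  have h1 : ∀ w, inner ℂ (w - R w) f - inner ℂ (R w) g = inner ℂ w (f - R (f + g)) := by
    intro w
    rw [inner_sub_left, inner_sub_right, ← hR.symm, inner_add_right]
    ring
  change (∀ a b, _ → inner ℂ b f - inner ℂ a g = 0) ↔ _
  set h := extResolvent A ψ
  constructor
  · intro hfg
    have h2 : ∀ w, inner ℂ h w = 0 → inner ℂ w (f - R (f + g)) = 0 := by
      intro w hw
      rw [← h1]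
      refine hfg _ _ ((hR.mem_graph_restrictKer hψ).mpr ?_)
      rw [add_sub_cancel]
      exact ⟨rfl, hw⟩
    obtain ⟨c, hc⟩ := exists_eq_smul_of_inner_eq_zero h0 h2
    exact ⟨c, by rw [← hc, add_sub_cancel]⟩
  · rintro ⟨α, hα⟩ a b hab
    obtain ⟨h2, h3⟩ := (hR.mem_graph_restrictKer hψ).mp hab
    have h4 := h1 (a + b)
    rw [h2, add_sub_cancel_left] at h4
    rw [h4, sub_eq_iff_eq_add'.mpr hα, inner_smul_right, ← inner_conj_symm, h3]
    simp

theorem mem_graph_regularizingOperator {r : ℝ} {f g : H} :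
    (f, g) ∈ (regularizingOperator A ψ r).graph ↔ ∃ α : ℂ,
      f = R (f + g) + α • extResolvent A ψ ∧ inner ℂ (extResolvent A ψ) (f + g) + α * r = 0 := by
  rw [regularizingOperator, mem_graph_domRestrict, hR.mem_graph_adjoint hψ hψ']
  have h1 : ∀ (u : A.domain) (α : ℂ), extFunctional A ψ r u α =
      inner ℂ (extResolvent A ψ) ((u : H) + A u) + α * r := fun u α => by
    rw [extFunctional, apply_eq_inner_extResolvent hψ, inner_conj_symm]
  constructor
  · rintro ⟨⟨u, β, hf, hu⟩, α, hα⟩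
    refine ⟨α, hα, ?_⟩
    have h2 : R (f + g) + α • extResolvent A ψ = R ((u : H) + A u) + β • extResolvent A ψ := by
      rw [← hα, hf, hR.apply_domain]
    obtain ⟨h3, rfl⟩ := hR.smul_extResolvent_injective hψ hψ' h2
    rw [h3, ← h1, hu]
  · rintro ⟨α, hα, hα'⟩
    refine ⟨⟨⟨R (f + g), hR.apply_mem_domain _⟩, α, hα, ?_⟩, α, hα⟩
    rw [h1, hR.apply_apply]
    change inner ℂ _ (R (f + g) + (f + g - R (f + g))) + _ = _
    rw [add_sub_cancel, hα']

end IsResolvent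

end Resolvent

/-! ### Green's identity and the classification of self-adjoint extensions. -/

section Extensions

attribute [local instance 10000] InnerProductSpace.toInner

variable {H : Type*} [NormedAddCommGroup H] [InnerProductSpace ℂ H] [CompleteSpace H]

theorem mem_graph_adjoint_iff {B : H →ₗ.[ℂ] H} (hB : Dense (B.domain : Set H)) {f g : H} :
    (f, g) ∈ B.adjoint.graph ↔
      ∀ a b, (a, b) ∈ B.graph → inner ℂ b f - inner ℂ a g = 0 := by
  rw [LinearPMap.adjoint_graph_eq_graph_adjoint hB, Submodule.mem_adjoint_iff]

theorem mem_graph_iff_of_isSelfAdjoint {B : H →ₗ.[ℂ] H} (hB : IsSelfAdjoint B) {f g : H} :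
    (f, g) ∈ B.graph ↔ ∀ a b, (a, b) ∈ B.graph → inner ℂ b f - inner ℂ a g = 0 := by
  rw [← mem_graph_adjoint_iff hB.dense_domain, LinearPMap.isSelfAdjoint_def.mp hB]

theorem eq_of_graph_le_of_isSelfAdjoint {B C : H →ₗ.[ℂ] H} (hB : IsSelfAdjoint B)
    (hC : IsSelfAdjoint C) (hBC : B.graph ≤ C.graph) : B = C := by
  refine LinearPMap.eq_of_eq_graph (le_antisymm hBC ?_)
  rintro ⟨f, g⟩ hfg
  rw [mem_graph_iff_of_isSelfAdjoint hB]
  exact fun a b hab => (mem_graph_iff_of_isSelfAdjoint hC).mp hfg a b (hBC hab)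

namespace IsResolvent

variable {A : H →ₗ.[ℂ] H} {R : H →L[ℂ] H} (hR : IsResolvent A R) {ψ : A.domain →ₗ⋆[ℂ] ℂ}
  (hψ : ψ ∈ HMinusTwo A) (hψ' : ψ ∉ Set.range (embed A))

include hR

omit [CompleteSpace H] in
/-- Green's identity for the adjoint of the restriction of `A`. -/
theorem inner_sub_inner_eq {f g f' g' h : H} {α β : ℂ} (hf : f = R (f + g) + α • h)
    (hf' : f' = R (f' + g') + β • h) :
    inner ℂ g f' - inner ℂ f g' =
      β * inner ℂ (f + g) h - conj α * inner ℂ h (f' + g') := by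
  have h1 : inner ℂ g f' - inner ℂ f g' = inner ℂ (f + g) f' - inner ℂ f (f' + g') := by
    rw [inner_add_left, inner_add_right]
    ring
  have h2 : inner ℂ (f + g) f' = inner ℂ (f + g) (R (f' + g')) + β * inner ℂ (f + g) h := by
    rw [← inner_smul_right, ← inner_add_right, ← hf']
  have h3 : inner ℂ f (f' + g') =
      inner ℂ (R (f + g)) (f' + g') + conj α * inner ℂ h (f' + g') := by
    rw [← inner_smul_left, ← inner_add_left, ← hf]
  rw [h1, h2, h3, hR.symm]
  ring

include hψ

theorem restrictKer_graph_le : (restrictKer A ψ).graph ≤ A.graph := by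
  rintro ⟨f, g⟩ hfg
  exact hR.mem_graph_iff.mpr ((hR.mem_graph_restrictKer hψ).mp hfg).1

include hψ'

/-- A point with boundary values `α = 1` and `⟨h, f + g⟩ = -r`: pairing with it reads off the
boundary condition. -/
theorem exists_mem_graph_regularizingOperator (r : ℝ) :
    ∃ f g, f = R (f + g) + (1 : ℂ) • extResolvent A ψ ∧
      inner ℂ (extResolvent A ψ) (f + g) + (1 : ℂ) * r = 0 ∧
      (f, g) ∈ (regularizingOperator A ψ r).graph := by
  have h0 : inner ℂ (extResolvent A ψ) (extResolvent A ψ) ≠ 0 :=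
    inner_self_ne_zero.mpr (hR.extResolvent_ne_zero hψ hψ')
  simp only [hR.mem_graph_regularizingOperator hψ hψ']
  set h := extResolvent A ψ
  set e := (-(r : ℂ) / inner ℂ h h) • h with he
  have h1 : (R e + (1 : ℂ) • h) + (e - (R e + (1 : ℂ) • h)) = e := add_sub_cancel _ _
  have h2 : inner ℂ h e + (1 : ℂ) * r = 0 := by
    rw [he, inner_smul_right, div_mul_cancel₀ _ h0, one_mul, neg_add_cancel]
  refine ⟨R e + (1 : ℂ) • h, e - (R e + (1 : ℂ) • h), ?_, ?_, 1, ?_, ?_⟩ <;> rw [h1]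
  exacts [h2, h2]

theorem restrictKer_graph_le_regularizingOperator (r : ℝ) :
    (restrictKer A ψ).graph ≤ (regularizingOperator A ψ r).graph := by
  rintro ⟨f, g⟩ hfg
  obtain ⟨h1, h2⟩ := (hR.mem_graph_restrictKer hψ).mp hfg
  exact (hR.mem_graph_regularizingOperator hψ hψ').mpr ⟨0, by rw [h1]; simp, by rw [h2]; simp⟩

theorem regularizingOperator_isSelfAdjoint (r : ℝ) :
    IsSelfAdjoint (regularizingOperator A ψ r) := by
  have hle := hR.restrictKer_graph_le_regularizingOperator hψ hψ' r
  have hd : Dense ((regularizingOperator A ψ r).domain : Set H) :=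
    (hR.dense_restrictKer hψ hψ').mono (LinearPMap.le_of_le_graph hle).1
  rw [LinearPMap.isSelfAdjoint_def]
  refine LinearPMap.eq_of_eq_graph (Submodule.ext ?_)
  rintro ⟨f', g'⟩
  rw [mem_graph_adjoint_iff hd]
  constructor
  · intro hfg
    obtain ⟨β, hβ⟩ := (hR.mem_graph_adjoint hψ hψ').mp
      ((mem_graph_adjoint_iff (hR.dense_restrictKer hψ hψ')).mpr fun a b hab =>
        hfg a b (hle hab))
    obtain ⟨f, g, h1, h2, h3⟩ := hR.exists_mem_graph_regularizingOperator hψ hψ' r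
    have h4 := hfg _ _ h3
    have h5 : inner ℂ (f + g) (extResolvent A ψ) = -r := by
      rw [← inner_conj_symm, eq_neg_of_add_eq_zero_left h2]
      simp
    rw [hR.inner_sub_inner_eq h1 hβ, h5, map_one] at h4
    exact (hR.mem_graph_regularizingOperator hψ hψ').mpr
      ⟨β, hβ, by linear_combination -h4⟩
  · rintro hfg a b hab
    obtain ⟨β, hβ, hβ'⟩ := (hR.mem_graph_regularizingOperator hψ hψ').mp hfg
    obtain ⟨α, hα, hα'⟩ := (hR.mem_graph_regularizingOperator hψ hψ').mp hab
    have h5 : inner ℂ (a + b) (extResolvent A ψ) = -(conj α * r) := by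
      rw [← inner_conj_symm, eq_neg_of_add_eq_zero_left hα']
      simp
    rw [hR.inner_sub_inner_eq hα hβ, h5]
    linear_combination -(conj α) * hβ'

theorem regularizingOperator_ne (r : ℝ) : regularizingOperator A ψ r ≠ A := by
  intro h
  obtain ⟨f, g, h1, -, h3⟩ := hR.exists_mem_graph_regularizingOperator hψ hψ' r
  rw [h, hR.mem_graph_iff] at h3
  rw [h3, one_smul, left_eq_add] at h1
  exact hR.extResolvent_ne_zero hψ hψ' h1

/-- The self-adjoint extensions of the restriction of `A` to `ker ψ`. -/
theorem isSelfAdjointExtension_iff (hA : IsSelfAdjoint A) {B : H →ₗ.[ℂ] H} :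
    IsSelfAdjointExtension (restrictKer A ψ) B ↔
      B = A ∨ ∃ r : ℝ, B = regularizingOperator A ψ r := by
  constructor
  · rintro ⟨hB, hSB⟩
    have hle := LinearPMap.le_graph_of_le hSB
    have h1 : ∀ {f g : H}, (f, g) ∈ B.graph → ∃ α : ℂ, f = R (f + g) + α • extResolvent A ψ := by
      intro f g hfg
      rw [mem_graph_iff_of_isSelfAdjoint hB] at hfg
      exact (hR.mem_graph_adjoint hψ hψ').mp
        ((mem_graph_adjoint_iff (hR.dense_restrictKer hψ hψ')).mpr fun a b hab =>
          hfg a b (hle hab))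
    by_cases h2 : B.graph ≤ A.graph
    · exact Or.inl (eq_of_graph_le_of_isSelfAdjoint hB hA h2)
    right
    obtain ⟨⟨f, g⟩, hfg, hfg'⟩ := Set.not_subset.mp h2
    obtain ⟨α, hα⟩ := h1 hfg
    have hα0 : α ≠ 0 := by
      rintro rfl
      refine hfg' (hR.mem_graph_iff.mpr ?_)
      rw [zero_smul, add_zero] at hα
      exact hα.symm
    -- One point of `B` outside `A` fixes the parameter `r = -t`. Green's identity for this point
    -- with itself makes `t` real, and with any other point yields the boundary condition.
    set t := inner ℂ (extResolvent A ψ) (f + g) / α with ht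
    have h3 : inner ℂ (extResolvent A ψ) (f + g) = α * t := (mul_div_cancel₀ _ hα0).symm
    have h4 : inner ℂ (f + g) (extResolvent A ψ) = conj α * conj t := by
      rw [← inner_conj_symm, h3, map_mul]
    have hα0' : conj α ≠ 0 := (map_ne_zero _).mpr hα0
    have h5 : conj t = t := by
      have h6 := (mem_graph_iff_of_isSelfAdjoint hB).mp hfg _ _ hfg
      rw [hR.inner_sub_inner_eq hα hα, h3, h4] at h6
      exact mul_left_cancel₀ (mul_ne_zero hα0 hα0') (by linear_combination h6)
    refine ⟨-t.re, eq_of_graph_le_of_isSelfAdjoint hB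
      (hR.regularizingOperator_isSelfAdjoint hψ hψ' _) ?_⟩
    rintro ⟨f', g'⟩ hfg₂
    obtain ⟨β, hβ⟩ := h1 hfg₂
    refine (hR.mem_graph_regularizingOperator hψ hψ').mpr ⟨β, hβ, ?_⟩
    have h6 := (mem_graph_iff_of_isSelfAdjoint hB).mp hfg₂ _ _ hfg
    rw [hR.inner_sub_inner_eq hα hβ, h4, h5] at h6
    rw [Complex.ofReal_neg, Complex.conj_eq_iff_re.mp h5]
    exact mul_left_cancel₀ hα0' (by linear_combination -h6)
  · rintro (rfl | ⟨r, rfl⟩)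
    · exact ⟨hA, LinearPMap.le_of_le_graph (hR.restrictKer_graph_le hψ)⟩
    · exact ⟨hR.regularizingOperator_isSelfAdjoint hψ hψ' r,
        LinearPMap.le_of_le_graph (hR.restrictKer_graph_le_regularizingOperator hψ hψ' r)⟩

end IsResolvent

end Extensions

/-! ### Energy space, admissible numbers, and the Friedrichs and Krein extensions. -/

section FriedrichsKrein

attribute [local instance 10000] InnerProductSpace.toInner

variable {H : Type*} [NormedAddCommGroup H] [InnerProductSpace ℂ H] [CompleteSpace H]

-- For `u = R y` this is `‖u‖² + (A u, u)`: the root of `R` carries the form norm to the norm of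
-- `H`.
omit [CompleteSpace H] in
theorem norm_sqrt_apply_sq {R T : H →L[ℂ] H} (hT : ∀ x y, inner ℂ (T x) y = inner ℂ x (T y))
    (hTT : ∀ x, T (T x) = R x) (y : H) :
    ‖T y‖ ^ 2 = ‖R y‖ ^ 2 + (inner ℂ (y - R y) (R y)).re := by
  rw [← re_inner_self, hT, hTT, ← re_inner_self (R y), ← Complex.add_re, ← inner_add_left,
    add_sub_cancel]

-- For `u = R y` this is `‖A u‖² + (A u, u)`, the norm in which the Krein extension is a closure.
omit [CompleteSpace H] in
theorem norm_sqrt_one_sub_apply_sq {R V : H →L[ℂ] H}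
    (hV : ∀ x y, inner ℂ (V x) y = inner ℂ x (V y)) (hVV : ∀ x, V (V x) = x - R x) (y : H) :
    ‖V y‖ ^ 2 = ‖(1 - R : H →L[ℂ] H) y‖ ^ 2 + (inner ℂ (y - R y) (R y)).re := by
  change _ = ‖y - R y‖ ^ 2 + _
  rw [← re_inner_self, ← hV, hVV, ← re_inner_self (y - R y), ← Complex.add_re, ← inner_add_right,
    sub_add_cancel]

namespace IsResolvent

variable {A : H →ₗ.[ℂ] H} {R : H →L[ℂ] H} (hR : IsResolvent A R)

include hR

omit [CompleteSpace H] in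
theorem quadForm_eq (u : A.domain) :
    quadForm A u = (inner ℂ (((u : H) + A u) - R ((u : H) + A u)) (R ((u : H) + A u))).re := by
  rw [hR.apply_domain, add_sub_cancel_left, quadForm]

omit [CompleteSpace H] in
theorem sqrt_apply_injective {T : H →L[ℂ] H} (hTT : ∀ x, T (T x) = R x) {x y : H}
    (h : T x = T y) : x = y := by
  refine sub_eq_zero.mp (hR.eq_zero_of_apply_eq_zero ?_)
  rw [← hTT, map_sub, h, sub_self, map_zero]

omit [CompleteSpace H] in
theorem mem_orthogonal_ker_sqrt {T : H →L[ℂ] H} (hTT : ∀ x, T (T x) = R x) (k : H) :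
    k ∈ (LinearMap.ker (T : H →ₗ[ℂ] H))ᗮ := by
  intro v hv
  have h1 : v = 0 := hR.sqrt_apply_injective hTT (by rw [map_zero]; exact hv)
  rw [h1, inner_zero_left]

omit [CompleteSpace H] in
theorem eq_of_graph_iff_eq_zero {B : H →ₗ.[ℂ] H} {h : H}
    (hB : ∀ f g, (f, g) ∈ B.graph ↔
      ∃ α : ℂ, f = R (f + g) + α • h ∧ α = 0) : B = A := by
  refine LinearPMap.eq_of_eq_graph (Submodule.ext ?_)
  rintro ⟨f, g⟩
  rw [hB, hR.mem_graph_iff]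
  constructor
  · rintro ⟨α, hα, rfl⟩
    rw [zero_smul, add_zero] at hα
    exact hα.symm
  · intro h
    exact ⟨0, by rw [h, zero_smul, add_zero], rfl⟩

theorem isFormLimit_iff {T : H →L[ℂ] H} (hT : ∀ x y, inner ℂ (T x) y = inner ℂ x (T y))
    (hTT : ∀ x, T (T x) = R x) {a : ℕ → A.domain} {f : H} :
    IsFormLimit A a f ↔
      ∃ l, T l = f ∧ Tendsto (fun n => T ((a n : H) + A (a n))) atTop (𝓝 l) := by
  have h1 : ∀ u : A.domain, T (T ((u : H) + A u)) = u := fun u => by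
    rw [hTT, hR.apply_domain]
  have h2 : ∀ u v : A.domain, dist (T ((u : H) + A u)) (T ((v : H) + A v)) ^ 2 =
      ‖(u : H) - v‖ ^ 2 + quadForm A (u - v) := fun u v => by
    rw [hR.quadForm_eq, dist_eq_norm, ← map_sub,
      show (u : H) + A u - ((v : H) + A v) = ((u - v : A.domain) : H) + A (u - v) by
        rw [A.map_sub, Submodule.coe_sub]; abel, norm_sqrt_apply_sq hT hTT,
      hR.apply_domain]
    rfl
  constructor
  · rintro ⟨haf, ha⟩
    have h3 : CauchySeq fun n => T ((a n : H) + A (a n)) := by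
      rw [cauchySeq_iff_tendsto_dist_atTop_0]
      have h4 := (cauchySeq_iff_tendsto_dist_atTop_0.mp haf.cauchySeq).pow 2
      rw [zero_pow two_ne_zero] at h4
      have h5 := (h4.add ha).sqrt
      rw [add_zero, Real.sqrt_zero] at h5
      refine Tendsto.congr (fun k => ?_) h5
      rw [dist_eq_norm, ← h2, Real.sqrt_sq dist_nonneg]
    obtain ⟨l, hl⟩ := cauchySeq_tendsto_of_complete h3
    refine ⟨l, tendsto_nhds_unique ((T.continuous.tendsto l).comp hl) ?_, hl⟩
    exact Tendsto.congr (fun n => (h1 (a n)).symm) haf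
  · rintro ⟨l, rfl, hl⟩
    refine ⟨Tendsto.congr (fun n => h1 (a n)) ((T.continuous.tendsto l).comp hl), ?_⟩
    have h4 := (cauchySeq_iff_tendsto_dist_atTop_0.mp hl.cauchySeq).pow 2
    rw [zero_pow two_ne_zero] at h4
    refine squeeze_zero (fun k => ?_) (fun k => ?_) h4
    · rw [hR.quadForm_eq]
      exact hR.nonneg _
    · rw [h2]
      exact le_add_of_nonneg_left (sq_nonneg _)

theorem exists_seq_tendsto_sqrt {T : H →L[ℂ] H}
    (hT : ∀ x y, inner ℂ (T x) y = inner ℂ x (T y)) (hTT : ∀ x, T (T x) = R x) (l : H) :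
    ∃ a : ℕ → A.domain, Tendsto (fun n => T ((a n : H) + A (a n))) atTop (𝓝 l) := by
  have hadj : ContinuousLinearMap.adjoint T = T :=
    (ContinuousLinearMap.eq_adjoint_iff T T).mpr hT |>.symm
  have h1 := hR.mem_orthogonal_ker_sqrt hTT l
  rw [ContinuousLinearMap.orthogonal_ker, hadj] at h1
  have h2 : l ∈ closure (Set.range T) := h1
  obtain ⟨w, hw, hw'⟩ := mem_closure_iff_seq_limit.mp h2
  choose y hy using hw
  refine ⟨fun n => ⟨R (y n), hR.apply_mem_domain _⟩, Tendsto.congr (fun n => ?_) hw'⟩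
  rw [hR.apply_apply, ← hy]
  change _ = T (R (y n) + (y n - R (y n)))
  rw [add_sub_cancel]

/-- By `isFormLimit_iff` the energy space is `ran T` with `T` isometric onto it, so the limit does
not depend on the approximating sequences. -/
theorem isEnergyInner_iff {T : H →L[ℂ] H} (hT : ∀ x y, inner ℂ (T x) y = inner ℂ x (T y))
    (hTT : ∀ x, T (T x) = R x) {k l : H} {c : ℂ} :
    IsEnergyInner A (T l) (T k) c ↔ c = inner ℂ k l := by
  have h1 : ∀ u v : A.domain, inner ℂ (v : H) (A u + (u : H)) =
      inner ℂ (T ((v : H) + A v)) (T ((u : H) + A u)) := fun u v => by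
    rw [hT, hTT, ← hR.symm, hR.apply_domain, add_comm]
  constructor
  · rintro ⟨a, b, ha, hb, hab⟩
    obtain ⟨l', hl', ha'⟩ := (hR.isFormLimit_iff hT hTT).mp ha
    obtain ⟨k', hk', hb'⟩ := (hR.isFormLimit_iff hT hTT).mp hb
    obtain rfl := hR.sqrt_apply_injective hTT hl'
    obtain rfl := hR.sqrt_apply_injective hTT hk'
    simp only [h1] at hab
    exact tendsto_nhds_unique hab (hb'.inner ha')
  · rintro rfl
    obtain ⟨a, ha⟩ := hR.exists_seq_tendsto_sqrt hT hTT l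
    obtain ⟨b, hb⟩ := hR.exists_seq_tendsto_sqrt hT hTT k
    refine ⟨a, b, (hR.isFormLimit_iff hT hTT).mpr ⟨l, rfl, ha⟩,
      (hR.isFormLimit_iff hT hTT).mpr ⟨k, rfl, hb⟩, ?_⟩
    simp only [h1]
    exact hb.inner ha

variable {ψ : A.domain →ₗ⋆[ℂ] ℂ} (hψ : ψ ∈ HMinusTwo A)

include hψ

theorem mem_HMinusOne_iff {T : H →L[ℂ] H} (hT : ∀ x y, inner ℂ (T x) y = inner ℂ x (T y))
    (hTT : ∀ x, T (T x) = R x) : ψ ∈ HMinusOne A ↔ ∃ k, T k = extResolvent A ψ := by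
  have h1 : ∀ u : A.domain,
      √(inner ℂ (A u + (u : H)) (u : H)).re = ‖T ((u : H) + A u)‖ := fun u => by
    have h2 : inner ℂ (A u + (u : H)) (u : H) =
        inner ℂ (T ((u : H) + A u)) (T ((u : H) + A u)) := by
      rw [hT, hTT, hR.apply_domain, add_comm]
    rw [h2, re_inner_self, Real.sqrt_sq (norm_nonneg _)]
  constructor
  · rintro ⟨C, hC⟩
    refine exists_apply_eq_of_bound hT (C := C) fun y => ?_
    have h3 := hC ⟨R y, hR.apply_mem_domain y⟩
    rw [h1, hR.functional_apply hψ, hR.apply_apply] at h3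
    change _ ≤ C * ‖T (R y + (y - R y))‖ at h3
    rwa [add_sub_cancel] at h3
  · rintro ⟨k, hk⟩
    refine ⟨‖k‖, fun u => ?_⟩
    rw [h1, apply_eq_inner_extResolvent hψ, ← hk, ← hT, mul_comm]
    exact norm_inner_le_norm _ _

/-- Testing on `f = h` gives `r = ‖h‖₁² = ‖k‖²`; conversely this value makes the identity hold for
every `u + α h`. -/
theorem isAdmissibleNumber_iff (hA : IsNonneg A) {T : H →L[ℂ] H}
    (hT : ∀ x y, inner ℂ (T x) y = inner ℂ x (T y)) (hTT : ∀ x, T (T x) = R x) {k : H}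
    (hk : T k = extResolvent A ψ) {r : ℝ} : IsAdmissibleNumber A hA ψ r ↔ r = ‖k‖ ^ 2 := by
  constructor
  · intro hr
    obtain ⟨a, ha⟩ := hR.exists_seq_tendsto_sqrt hT hTT k
    have h1 : IsFormLimit A a (T k) := (hR.isFormLimit_iff hT hTT).mpr ⟨k, rfl, ha⟩
    have h2 : ((0 : A.domain) : H) + (1 : ℂ) • extResolvent A ψ = T k := by simp [hk]
    have h3 := hr ((hR.mem_HMinusOne_iff hψ hT hTT).mpr ⟨k, hk⟩) 0 1 (by rw [h2]; exact ⟨a, h1⟩)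
    rw [h2, ← hk, hR.isEnergyInner_iff hT hTT, inner_self_ofReal, extFunctional] at h3
    simp only [map_zero, one_mul, zero_add] at h3
    exact_mod_cast h3
  · rintro rfl - u α -
    have h1 : (u : H) + α • extResolvent A ψ = T (T ((u : H) + A u) + α • k) := by
      rw [map_add, map_smul, hk, hTT, hR.apply_domain]
    rw [h1, ← hk, hR.isEnergyInner_iff hT hTT, extFunctional, apply_eq_inner_extResolvent hψ,
      inner_add_right, inner_smul_right, inner_self_ofReal, inner_conj_symm, ← hk, hT]

/-- `P` stands for the convergence demanded in `H`: of `a n` for Friedrichs, of `S (a n)` for Krein.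
-/
theorem exists_seq_restrictKer_iff (P : (ℕ → H) → (ℕ → H) → Prop) :
    (∃ a : ℕ → (restrictKer A ψ).domain,
      P (fun n => (a n : H)) (fun n => restrictKer A ψ (a n)) ∧ FormCauchy (restrictKer A ψ) a) ↔
    ∃ y : ℕ → H, (∀ n, inner ℂ (extResolvent A ψ) (y n) = 0) ∧
      P (fun n => R (y n)) (fun n => y n - R (y n)) ∧
      Tendsto (fun k : ℕ × ℕ =>
        (inner ℂ ((y k.1 - y k.2) - R (y k.1 - y k.2)) (R (y k.1 - y k.2))).re) atTop (𝓝 0) := by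
  have key : ∀ (a : ℕ → (restrictKer A ψ).domain) (y : ℕ → H),
      (∀ n, (a n : H) = R (y n)) → (∀ n, restrictKer A ψ (a n) = y n - R (y n)) →
      (FormCauchy (restrictKer A ψ) a ↔ Tendsto (fun k : ℕ × ℕ =>
        (inner ℂ ((y k.1 - y k.2) - R (y k.1 - y k.2)) (R (y k.1 - y k.2))).re)
          atTop (𝓝 0)) := by
    intro a y h1 h2
    refine tendsto_congr fun k => ?_
    rw [quadForm, LinearPMap.map_sub, Submodule.coe_sub, h1, h1, h2, h2, map_sub,
      sub_sub_sub_comm]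
  constructor
  · rintro ⟨a, hP, ha⟩
    have h1 : ∀ n, R ((a n : H) + restrictKer A ψ (a n)) = a n ∧
        inner ℂ (extResolvent A ψ) ((a n : H) + restrictKer A ψ (a n)) = 0 := fun n =>
      (hR.mem_graph_restrictKer hψ).mp ((restrictKer A ψ).mem_graph (a n))
    have h2 : ∀ n, restrictKer A ψ (a n) = ((a n : H) + restrictKer A ψ (a n)) -
        R ((a n : H) + restrictKer A ψ (a n)) := fun n => by
      rw [(h1 n).1, add_sub_cancel_left]
    refine ⟨fun n => (a n : H) + restrictKer A ψ (a n), fun n => (h1 n).2, ?_,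
      (key a _ (fun n => (h1 n).1.symm) h2).mp ha⟩
    convert hP using 2 with n n
    · exact (h1 n).1
    · exact (h2 n).symm
  · rintro ⟨y, hy, hP, hyφ⟩
    have h1 : ∀ n, (R (y n), y n - R (y n)) ∈ (restrictKer A ψ).graph := fun n => by
      rw [hR.mem_graph_restrictKer hψ, add_sub_cancel]
      exact ⟨rfl, hy n⟩
    have h2 : ∀ n, restrictKer A ψ ⟨R (y n), LinearPMap.mem_domain_of_mem_graph (h1 n)⟩ =
        y n - R (y n) := fun n => ((LinearPMap.image_iff _).mpr (h1 n)).symm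
    refine ⟨fun n => ⟨R (y n), LinearPMap.mem_domain_of_mem_graph (h1 n)⟩, ?_,
      (key _ y (fun n => rfl) h2).mpr hyφ⟩
    simpa only [h2] using hP

variable (hψ' : ψ ∉ Set.range (embed A))

include hψ'

theorem mem_graph_symFriedrichs (hA : IsNonneg A) {T : H →L[ℂ] H}
    (hT : ∀ x y, inner ℂ (T x) y = inner ℂ x (T y)) (hTT : ∀ x, T (T x) = R x) {f g : H} :
    (f, g) ∈ (symFriedrichs A hA ψ).graph ↔ ∃ α : ℂ, f = R (f + g) + α • extResolvent A ψ ∧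
      LimitRelation T (extResolvent A ψ) (-inner ℂ (extResolvent A ψ) (f + g)) α := by
  rw [symFriedrichs, friedrichsExtension, mem_graph_domRestrict, hR.mem_graph_adjoint hψ hψ',
    and_comm, ← exists_and_right]
  refine exists_congr fun α => and_congr_right fun hα => ?_
  rw [← exists_seq_iff_limitRelation hTT hR.nonneg (norm_sqrt_apply_sq hT hTT) hα]
  exact hR.exists_seq_restrictKer_iff hψ fun a _ => Tendsto a atTop (𝓝 f)

/-- Exchanging `f` with `g` exchanges `R` with `1 - R` and, since `g = (1 - R) (f + g) - α h`,
changes the sign of `α`. This is why the Krein parameter is negative. -/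
theorem mem_graph_symKrein (hA : IsNonneg A) {V : H →L[ℂ] H}
    (hV : ∀ x y, inner ℂ (V x) y = inner ℂ x (V y)) (hVV : ∀ x, V (V x) = x - R x) {f g : H} :
    (f, g) ∈ (symKrein A hA ψ).graph ↔ ∃ α : ℂ, f = R (f + g) + α • extResolvent A ψ ∧
      LimitRelation V (extResolvent A ψ) (-inner ℂ (extResolvent A ψ) (f + g)) (-α) := by
  rw [symKrein, kreinExtension, mem_graph_domRestrict, hR.mem_graph_adjoint hψ hψ',
    and_comm, ← exists_and_right]
  refine exists_congr fun α => and_congr_right fun hα => ?_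
  have h1 : g = (1 - R : H →L[ℂ] H) (f + g) + (-α) • extResolvent A ψ := by
    change g = f + g - R (f + g) + _
    rw [neg_smul, ← sub_eq_add_neg, sub_sub, ← hα, add_sub_cancel_left]
  rw [← exists_seq_iff_limitRelation (Z := 1 - R) hVV hR.nonneg
    (norm_sqrt_one_sub_apply_sq hV hVV) h1]
  refine Iff.trans ?_ (hR.exists_seq_restrictKer_iff hψ fun _ b => Tendsto b atTop (𝓝 g))
  have h2 : (f, g) ∈ (restrictKer A ψ).adjoint.graph :=
    (hR.mem_graph_adjoint hψ hψ').mpr ⟨α, hα⟩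
  have h3 := LinearPMap.mem_domain_of_mem_graph h2
  have h4 : (restrictKer A ψ).adjoint ⟨f, h3⟩ = g := ((LinearPMap.image_iff h3).mpr h2).symm
  constructor
  · rintro ⟨_, a, ha, ha'⟩
    exact ⟨a, h4 ▸ ha, ha'⟩
  · rintro ⟨a, ha, ha'⟩
    exact ⟨h3, a, h4.symm ▸ ha, ha'⟩

theorem eq_regularizingOperator_of_graph_iff {B : H →ₗ.[ℂ] H} {r : ℝ}
    (hB : ∀ f g, (f, g) ∈ B.graph ↔ ∃ α : ℂ, f = R (f + g) + α • extResolvent A ψ ∧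
      inner ℂ (extResolvent A ψ) (f + g) + α * r = 0) : B = regularizingOperator A ψ r := by
  refine LinearPMap.eq_of_eq_graph (Submodule.ext ?_)
  rintro ⟨f, g⟩
  rw [hB, hR.mem_graph_regularizingOperator hψ hψ']

theorem symFriedrichs_eq_self (hA : IsNonneg A) {T : H →L[ℂ] H}
    (hT : ∀ x y, inner ℂ (T x) y = inner ℂ x (T y)) (hTT : ∀ x, T (T x) = R x)
    (hTh : ∀ k, T k ≠ extResolvent A ψ) : symFriedrichs A hA ψ = A := by
  refine hR.eq_of_graph_iff_eq_zero (h := extResolvent A ψ) fun f g => ?_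
  rw [hR.mem_graph_symFriedrichs hψ hψ' hA hT hTT]
  simp only [limitRelation_iff_of_notMem_range hT hTh]

theorem symKrein_eq_self (hA : IsNonneg A) {V : H →L[ℂ] H}
    (hV : ∀ x y, inner ℂ (V x) y = inner ℂ x (V y)) (hVV : ∀ x, V (V x) = x - R x)
    (hVh : ∀ k, V k ≠ extResolvent A ψ) : symKrein A hA ψ = A := by
  refine hR.eq_of_graph_iff_eq_zero (h := extResolvent A ψ) fun f g => ?_
  rw [hR.mem_graph_symKrein hψ hψ' hA hV hVV]
  simp only [limitRelation_iff_of_notMem_range hV hVh, neg_eq_zero]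

theorem symFriedrichs_eq_regularizingOperator (hA : IsNonneg A) {T : H →L[ℂ] H}
    (hT : ∀ x y, inner ℂ (T x) y = inner ℂ x (T y)) (hTT : ∀ x, T (T x) = R x) {k : H}
    (hk : T k = extResolvent A ψ) :
    symFriedrichs A hA ψ = regularizingOperator A ψ (‖k‖ ^ 2) := by
  refine hR.eq_regularizingOperator_of_graph_iff hψ hψ' fun f g => ?_
  rw [hR.mem_graph_symFriedrichs hψ hψ' hA hT hTT]
  simp only [limitRelation_iff_of_apply_eq hT (hR.extResolvent_ne_zero hψ hψ') hk
    (hR.mem_orthogonal_ker_sqrt hTT k), neg_eq_iff_add_eq_zero]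

theorem symKrein_eq_regularizingOperator (hA : IsNonneg A) {V : H →L[ℂ] H}
    (hV : ∀ x y, inner ℂ (V x) y = inner ℂ x (V y)) (hVV : ∀ x, V (V x) = x - R x) {k : H}
    (hk : V k = extResolvent A ψ) (hk' : k ∈ (LinearMap.ker (V : H →ₗ[ℂ] H))ᗮ) :
    symKrein A hA ψ = regularizingOperator A ψ (-‖k‖ ^ 2) := by
  refine hR.eq_regularizingOperator_of_graph_iff hψ hψ' fun f g => ?_
  rw [hR.mem_graph_symKrein hψ hψ' hA hV hVV]
  simp only [limitRelation_iff_of_apply_eq hV (hR.extResolvent_ne_zero hψ hψ') hk hk',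
    neg_eq_iff_add_eq_zero, neg_mul, Complex.ofReal_neg, mul_neg]

end IsResolvent

end FriedrichsKrein

/-! ### Homogeneity as graph invariance, its action on boundary values, negative eigenvectors. -/

section Homogeneous

attribute [local instance 10000] InnerProductSpace.toInner

variable {H : Type*} [NormedAddCommGroup H] [InnerProductSpace ℂ H]

/-- Since the family contains the inverses, one inclusion of graphs for every `t` already gives the
equality of domains. -/
theorem isHomogeneous_iff {T : Set ℝ} {U : T → H ≃ₗᵢ[ℂ] H} {p : T → ℝ}
    (hU : ∀ t : T, ∃ s : T, U s = (U t).symm) (hp : ∀ t, p t ≠ 0) {B : H →ₗ.[ℂ] H} :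
    IsHomogeneous U p B ↔ (∃ x : B.domain, B x ≠ 0) ∧
      ∀ t f g, (f, g) ∈ B.graph → (U t f, (p t : ℂ)⁻¹ • U t g) ∈ B.graph := by
  have hpt : ∀ t, (p t : ℂ) ≠ 0 := fun t => Complex.ofReal_ne_zero.mpr (hp t)
  refine and_congr_right fun _ => ⟨fun h t f g hfg => ?_, fun h t => ?_⟩
  · obtain ⟨h1, h2⟩ := h t
    obtain ⟨u, rfl, rfl⟩ := (LinearPMap.mem_graph_iff _).mp hfg
    have h3 := (h1 u).mp u.2
    have h4 : (p t : ℂ)⁻¹ • U t (B u) = B ⟨U t u, h3⟩ := by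
      rw [inv_smul_eq_iff₀ (hpt t)]
      exact h2 u u.2 h3
    change (U t u, (p t : ℂ)⁻¹ • U t (B u)) ∈ _
    rw [h4]
    exact B.mem_graph ⟨_, h3⟩
  · have h1 : ∀ t, ∀ x ∈ B.domain, U t x ∈ B.domain := fun t x hx =>
      LinearPMap.mem_domain_of_mem_graph (h t _ _ (B.mem_graph ⟨x, hx⟩))
    refine ⟨fun x => ⟨h1 t x, fun hx => ?_⟩, fun x hx hx' => ?_⟩
    · obtain ⟨s, hs⟩ := hU t
      have h2 := h1 s _ hx
      rwa [hs, LinearIsometryEquiv.symm_apply_apply] at h2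
    · rw [← inv_smul_eq_iff₀ (hpt t)]
      exact (LinearPMap.image_iff hx').mpr (h t _ _ (B.mem_graph ⟨x, hx⟩))

/-- `V A ⊆ p A V` for a unitary `V`, in terms of the graph of `A`. -/
def GraphInvariant (V : H ≃ₗᵢ[ℂ] H) (p : ℝ) (A : H →ₗ.[ℂ] H) : Prop :=
  ∀ f g, (f, g) ∈ A.graph → (V f, (p : ℂ)⁻¹ • V g) ∈ A.graph

theorem quadForm_map {V : H ≃ₗᵢ[ℂ] H} {p : ℝ} {S : H →ₗ.[ℂ] H} {u v : S.domain}
    (hv : (v : H) = V u) (hSv : S v = (p : ℂ)⁻¹ • V (S u)) :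
    quadForm S v = p⁻¹ * quadForm S u := by
  rw [quadForm, hv, hSv, inner_smul_left, V.inner_map_map, ← Complex.ofReal_inv,
    Complex.conj_ofReal, Complex.re_ofReal_mul, quadForm]

theorem GraphInvariant.exists_map {V : H ≃ₗᵢ[ℂ] H} {p : ℝ} {S : H →ₗ.[ℂ] H}
    (hS : GraphInvariant V p S) (a : ℕ → S.domain) :
    ∃ b : ℕ → S.domain, (∀ n, (b n : H) = V (a n)) ∧ (∀ n, S (b n) = (p : ℂ)⁻¹ • V (S (a n))) ∧
      (FormCauchy S a → FormCauchy S b) := by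
  have h1 : ∀ n, ∃ b : S.domain, (b : H) = V (a n) ∧ S b = (p : ℂ)⁻¹ • V (S (a n)) := fun n =>
    (LinearPMap.mem_graph_iff _).mp (hS _ _ (S.mem_graph (a n)))
  choose b hb hb' using h1
  refine ⟨b, hb, hb', fun ha => ?_⟩
  have h2 := Tendsto.const_mul p⁻¹ ha
  rw [mul_zero] at h2
  refine Tendsto.congr (fun k => (quadForm_map (V := V) ?_ ?_).symm) h2
  · rw [Submodule.coe_sub, Submodule.coe_sub, hb, hb, map_sub]
  · rw [LinearPMap.map_sub, LinearPMap.map_sub, hb', hb', map_sub, smul_sub]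

namespace IsResolvent

variable {A : H →ₗ.[ℂ] H} {R : H →L[ℂ] H} (hR : IsResolvent A R)

include hR in
theorem apply_unitary_of_graphInvariant {V : H ≃ₗᵢ[ℂ] H} {p : ℝ} (hV : GraphInvariant V p A)
    (y : H) : R (V (R y) + (p : ℂ)⁻¹ • V (y - R y)) = V (R y) :=
  hR.mem_graph_iff.mp (hV _ _ (hR.apply_mem_graph y))

variable [CompleteSpace H]

-- If `p ≤ 0`, the form of `A` is both nonnegative and nonpositive, so `R - R²` has zero form and
-- vanishes by Cauchy–Schwarz, which forces `A = 0`.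
include hR in
theorem pos_of_isHomogeneous (hA : IsNonneg A) {V : H ≃ₗᵢ[ℂ] H} {p : ℝ}
    (hne : ∃ x : A.domain, A x ≠ 0) (hVA : ∀ x : H, x ∈ A.domain → V x ∈ A.domain)
    (hV : ∀ (x : H) (hx : x ∈ A.domain) (hx' : V x ∈ A.domain),
      V (A ⟨x, hx⟩) = (p : ℂ) • A ⟨V x, hx'⟩) : 0 < p := by
  by_contra! hp
  have h1 : ∀ u : A.domain, (inner ℂ (A u) (u : H)).re ≤ 0 := by
    intro u
    have h2 := hV u u.2 (hVA u u.2)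
    have h3 : inner ℂ (A u) (u : H) = p * inner ℂ (A ⟨V u, hVA u u.2⟩) (V u) := by
      rw [← V.inner_map_map, ← Complex.conj_ofReal p, ← inner_smul_left, ← h2]
    rw [h3, Complex.re_ofReal_mul]
    exact mul_nonpos_of_nonpos_of_nonneg hp (hA ⟨V u, hVA u u.2⟩)
  have h4 : ∀ y, (inner ℂ ((R - R * R) y) y).re = 0 := fun y => by
    have h5 := h1 ⟨R y, hR.apply_mem_domain y⟩
    rw [hR.apply_apply] at h5
    have h6 : inner ℂ ((R - R * R) y) y = inner ℂ (y - R y) (R y) := by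
      change inner ℂ (R y - R (R y)) y = _
      rw [← map_sub, hR.symm]
    rw [h6]
    exact le_antisymm h5 (hR.nonneg y)
  have h7 : ∀ x y, inner ℂ ((R - R * R) x) y = inner ℂ x ((R - R * R) y) := fun x y => by
    change inner ℂ (R x - R (R x)) y = inner ℂ x (R y - R (R y))
    simp only [inner_sub_left, inner_sub_right, hR.symm]
  obtain ⟨u, hu⟩ := hne
  set y := (u : H) + A u with hy
  have h8 := norm_inner_apply_sq_le h7 (fun x => (h4 x).ge) y ((R - R * R) y)
  rw [h4, zero_mul, inner_self_ofReal] at h8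
  have h9 : (R - R * R) y = 0 := by
    have h10 := pow_eq_zero_iff two_ne_zero |>.mp (le_antisymm h8 (sq_nonneg _))
    have h11 := Complex.ofReal_eq_zero.mp (norm_eq_zero.mp h10)
    exact norm_eq_zero.mp (pow_eq_zero_iff two_ne_zero |>.mp h11)
  have h12 : R (y - R y) = 0 := by
    rw [map_sub]
    exact h9
  have h13 := hR.eq_zero_of_apply_eq_zero h12
  rw [hy, hR.apply_domain, add_sub_cancel_left] at h13
  exact hu h13

variable {ψ : A.domain →ₗ⋆[ℂ] ℂ} (hψ : ψ ∈ HMinusTwo A)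

section Invariant

variable {V : H ≃ₗᵢ[ℂ] H} {p ξ : ℝ} (hp : p ≠ 0) (hV : GraphInvariant V p A)
  (hVs : ∃ hV : ∀ u ∈ A.domain, V.symm u ∈ A.domain, extUnitary A V hV ψ = (ξ : ℂ) • ψ)

include hψ hV hVs in
theorem inner_eq_mul_inner_map {f g : H} (hfg : (f, g) ∈ A.graph) :
    inner ℂ (extResolvent A ψ) (f + g) =
      ξ * inner ℂ (extResolvent A ψ) (V f + (p : ℂ)⁻¹ • V g) := by
  obtain ⟨hVd, hVe⟩ := hVs
  obtain ⟨v, hv, hv'⟩ := (LinearPMap.mem_graph_iff _).mp (hV _ _ hfg)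
  obtain ⟨u, hu, hu'⟩ := (LinearPMap.mem_graph_iff _).mp hfg
  have h1 := LinearMap.congr_fun hVe v
  change ψ ⟨V.symm v, hVd v v.2⟩ = ξ * ψ v at h1
  have h2 : (⟨V.symm v, hVd v v.2⟩ : A.domain) = u := by
    refine Subtype.ext ?_
    change V.symm (v : H) = u
    rw [hv, hu]
    exact V.symm_apply_apply f
  rw [h2, apply_eq_inner_extResolvent hψ, apply_eq_inner_extResolvent hψ, hu, hu', hv, hv'] at h1
  have h3 := congrArg conj h1
  rwa [map_mul, inner_conj_symm, inner_conj_symm, Complex.conj_ofReal] at h3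

include hR hψ hp hV hVs

/-- Formally `V 𝔸 = p 𝔸 V` and `𝕍 ψ = ξ ψ` with `ψ = (𝔸 + I) h` give `(p 𝔸 + I) V h = ξ (𝔸 + I) h`;
now apply `R`. -/
theorem smul_extResolvent_eq :
    (ξ : ℂ) • extResolvent A ψ =
      R (V (extResolvent A ψ)) + (p : ℂ) • (V (extResolvent A ψ) - R (V (extResolvent A ψ))) := by
  have hpc : (p : ℂ) ≠ 0 := Complex.ofReal_ne_zero.mpr hp
  obtain ⟨hVd, hVe⟩ := hVs
  refine ext_inner_left ℂ fun y => ?_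
  set h := extResolvent A ψ with hh
  have h1 := LinearMap.congr_fun hVe ⟨R y, hR.apply_mem_domain y⟩
  change ψ ⟨V.symm (R y), hVd _ (hR.apply_mem_domain y)⟩ = ξ * ψ ⟨R y, hR.apply_mem_domain y⟩ at h1
  rw [hR.functional_apply hψ, apply_eq_inner_extResolvent hψ] at h1
  have h2 : (R y, (p : ℂ)⁻¹ • V (A ⟨V.symm (R y), hVd _ (hR.apply_mem_domain y)⟩)) ∈ A.graph := by
    have h3 := hV _ _ (A.mem_graph ⟨V.symm (R y), hVd _ (hR.apply_mem_domain y)⟩)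
    have h4 : V (V.symm (R y)) = R y := V.apply_symm_apply _
    change (V (V.symm (R y)), _) ∈ _ at h3
    rwa [h4] at h3
  have h5 := A.mem_graph_snd_inj h2 (hR.apply_mem_graph y) rfl
  rw [inv_smul_eq_iff₀ hpc] at h5
  rw [inner_smul_right, ← h1, ← V.inner_map_map, map_add]
  change inner ℂ (V (V.symm (R y)) + V (A _)) _ = _
  rw [h5, V.apply_symm_apply, inner_add_left, inner_smul_left, Complex.conj_ofReal,
    inner_add_right, inner_smul_right, inner_sub_left, inner_sub_right, hR.symm]

variable (hψ' : ψ ∉ Set.range (embed A))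

include hψ'

omit hp in
theorem invariance_ne_zero : ξ ≠ 0 := by
  rintro rfl
  refine hR.extResolvent_ne_zero hψ hψ' (inner_self_eq_zero (𝕜 := ℂ).mp ?_)
  have h1 := inner_eq_mul_inner_map hψ hV hVs (hR.apply_mem_graph (extResolvent A ψ))
  rwa [add_sub_cancel, Complex.ofReal_zero, zero_mul] at h1

/-- The action of `V` on the two boundary values, obtained by splitting `f` into `R (f + g)`, on
which `A` is homogeneous, and `α h`, on which `smul_extResolvent_eq` applies. -/
theorem apply_map_adjoint {f g : H} {α : ℂ} (hα : f = R (f + g) + α • extResolvent A ψ) :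
    V f = R (V f + (p : ℂ)⁻¹ • V g) + (α * ξ * (p : ℂ)⁻¹) • extResolvent A ψ ∧
      inner ℂ (extResolvent A ψ) (V f + (p : ℂ)⁻¹ • V g) =
        (ξ : ℂ)⁻¹ * inner ℂ (extResolvent A ψ) (f + g) +
          α * (1 - (p : ℂ)⁻¹) * inner ℂ (extResolvent A ψ) (V (extResolvent A ψ)) := by
  have hpc : (p : ℂ) ≠ 0 := Complex.ofReal_ne_zero.mpr hp
  have hξ : (ξ : ℂ) ≠ 0 :=
    Complex.ofReal_ne_zero.mpr (hR.invariance_ne_zero hψ hV hVs hψ')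
  have h1 := hR.smul_extResolvent_eq hψ hp hV hVs
  have h2 := inner_eq_mul_inner_map hψ hV hVs (hR.apply_mem_graph (f + g))
  have h3 := hR.apply_unitary_of_graphInvariant hV (f + g)
  set h := extResolvent A ψ
  have h4 : V f = V (R (f + g)) + α • V h := by
    rw [← map_smul, ← map_add, ← hα]
  have h5 : V g = V (f + g - R (f + g)) - α • V h := by
    rw [← map_smul, ← map_sub, sub_sub, ← hα, add_sub_cancel_left]
  have h6 : V f + (p : ℂ)⁻¹ • V g = (V (R (f + g)) + (p : ℂ)⁻¹ • V (f + g - R (f + g))) +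
      (α * (1 - (p : ℂ)⁻¹)) • V h := by
    rw [h5, h4]
    module
  constructor
  · have h7 : (α * ξ * (p : ℂ)⁻¹) • h = (α * (p : ℂ)⁻¹) • ((ξ : ℂ) • h) := by
      rw [smul_smul, mul_right_comm]
    have h8 : (α * (p : ℂ)⁻¹) • (p : ℂ) • (V h - R (V h)) = α • (V h - R (V h)) := by
      rw [smul_smul, mul_assoc, inv_mul_cancel₀ hpc, mul_one]
    rw [h6, map_add, h3, map_smul, h7, h1, smul_add, h8, h4]
    module
  · rw [add_sub_cancel] at h2
    rw [h6, inner_add_right, inner_smul_right, h2, inv_mul_cancel_left₀ hξ]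

theorem graphInvariant_restrictKer : GraphInvariant V p (restrictKer A ψ) := by
  intro f g hfg
  obtain ⟨h1, h2⟩ := (hR.mem_graph_restrictKer hψ).mp hfg
  obtain ⟨h3, h4⟩ := hR.apply_map_adjoint hψ hp hV hVs hψ' (f := f) (g := g) (α := 0)
    (by rw [h1]; simp)
  refine (hR.mem_graph_restrictKer hψ).mpr ⟨?_, ?_⟩
  · simpa using h3.symm
  · simpa [h2] using h4

theorem graphInvariant_adjoint : GraphInvariant V p (restrictKer A ψ).adjoint := by
  intro f g hfg
  obtain ⟨α, hα⟩ := (hR.mem_graph_adjoint hψ hψ').mp hfg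
  exact (hR.mem_graph_adjoint hψ hψ').mpr
    ⟨_, (hR.apply_map_adjoint hψ hp hV hVs hψ' hα).1⟩

theorem graphInvariant_regularizingOperator_iff {r : ℝ} :
    GraphInvariant V p (regularizingOperator A ψ r) ↔
      ((ξ : ℂ) ^ 2 - (p : ℂ)) * (r : ℂ) =
        (ξ : ℂ) * (1 - (p : ℂ)) * inner ℂ (V (extResolvent A ψ)) (extResolvent A ψ) := by
  have hpc : (p : ℂ) ≠ 0 := Complex.ofReal_ne_zero.mpr hp
  have hξ : (ξ : ℂ) ≠ 0 :=
    Complex.ofReal_ne_zero.mpr (hR.invariance_ne_zero hψ hV hVs hψ')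
  -- The transformation law contains `inner ℂ h (V h)`, the scalar equation its conjugate.
  have hconj : (((ξ : ℂ) ^ 2 - (p : ℂ)) * (r : ℂ) =
      (ξ : ℂ) * (1 - (p : ℂ)) * inner ℂ (V (extResolvent A ψ)) (extResolvent A ψ)) ↔
      (-(ξ : ℂ)⁻¹ * r + (1 - (p : ℂ)⁻¹) * inner ℂ (extResolvent A ψ) (V (extResolvent A ψ)) +
        ξ * (p : ℂ)⁻¹ * r = 0) := by
    rw [← (starRingEnd ℂ).injective.eq_iff]
    simp only [map_mul, map_sub, map_pow, map_one, Complex.conj_ofReal, inner_conj_symm]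
    constructor
    · intro h
      field_simp
      linear_combination h
    · intro h
      field_simp at h
      linear_combination h
  rw [hconj]
  constructor
  · intro hinv
    obtain ⟨f, g, h1, h2, h3⟩ := hR.exists_mem_graph_regularizingOperator hψ hψ' r
    obtain ⟨β, h4, h5⟩ := (hR.mem_graph_regularizingOperator hψ hψ').mp (hinv _ _ h3)
    obtain ⟨h6, h7⟩ := hR.apply_map_adjoint hψ hp hV hVs hψ' h1
    obtain ⟨-, h8⟩ := hR.smul_extResolvent_injective hψ hψ' (h4.symm.trans h6)
    rw [h7, h8, eq_neg_of_add_eq_zero_left h2] at h5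
    linear_combination h5
  · intro hr f g hfg
    obtain ⟨α, h1, h2⟩ := (hR.mem_graph_regularizingOperator hψ hψ').mp hfg
    obtain ⟨h6, h7⟩ := hR.apply_map_adjoint hψ hp hV hVs hψ' h1
    refine (hR.mem_graph_regularizingOperator hψ hψ').mpr ⟨_, h6, ?_⟩
    rw [h7, eq_neg_of_add_eq_zero_left h2]
    linear_combination α * hr

theorem graphInvariant_symFriedrichs (hA : IsNonneg A) :
    GraphInvariant V p (symFriedrichs A hA ψ) := by
  intro f g hfg
  rw [symFriedrichs, friedrichsExtension, mem_graph_domRestrict] at hfg ⊢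
  obtain ⟨⟨a, ha, ha'⟩, hfg⟩ := hfg
  refine ⟨?_, hR.graphInvariant_adjoint hψ hp hV hVs hψ' _ _ hfg⟩
  obtain ⟨b, hb, -, hb'⟩ := (hR.graphInvariant_restrictKer hψ hp hV hVs hψ').exists_map a
  refine ⟨b, ?_, hb' ha'⟩
  simp only [hb]
  exact (V.continuous.tendsto f).comp ha

theorem graphInvariant_symKrein (hA : IsNonneg A) :
    GraphInvariant V p (symKrein A hA ψ) := by
  intro f g hfg
  rw [symKrein, kreinExtension, mem_graph_domRestrict] at hfg ⊢
  obtain ⟨⟨hf, a, ha, ha'⟩, hfg⟩ := hfg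
  have h1 := hR.graphInvariant_adjoint hψ hp hV hVs hψ' _ _ hfg
  refine ⟨⟨LinearPMap.mem_domain_of_mem_graph h1, ?_⟩, h1⟩
  obtain ⟨b, -, hb, hb'⟩ := (hR.graphInvariant_restrictKer hψ hp hV hVs hψ').exists_map a
  refine ⟨b, ?_, hb' ha'⟩
  rw [← (LinearPMap.image_iff _).mpr h1, (LinearPMap.image_iff hf).mpr hfg]
  simp only [hb]
  exact ((V.continuous.tendsto _).comp ha).const_smul _

end Invariant

variable (hψ' : ψ ∉ Set.range (embed A))

include hR hψ hψ'

/-- If `B = 0`, then `R` is the identity on `h^⊥`; being symmetric it has `h` as an eigenvector, and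
so `h ∈ ran R` or `R h = 0`, both impossible. -/
theorem exists_apply_ne_zero {B : H →ₗ.[ℂ] H} (hB : restrictKer A ψ ≤ B) :
    ∃ x : B.domain, B x ≠ 0 := by
  by_contra! hcon
  have h1 : ∀ w, inner ℂ (extResolvent A ψ) w = 0 → w - R w = 0 := by
    intro w hw
    have h2 : (R w, w - R w) ∈ (restrictKer A ψ).graph := by
      rw [hR.mem_graph_restrictKer hψ, add_sub_cancel]
      exact ⟨rfl, hw⟩
    obtain ⟨x, -, hx⟩ := (LinearPMap.mem_graph_iff _).mp (LinearPMap.le_graph_of_le hB h2)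
    rw [hcon] at hx
    exact hx.symm
  have h3 := hR.extResolvent_notMem_range hψ hψ'
  have h4 := hR.extResolvent_ne_zero hψ hψ'
  set h := extResolvent A ψ
  obtain ⟨c, hc⟩ := exists_eq_smul_of_inner_eq_zero (m := h - R h) h4 fun w hw => by
    rw [inner_sub_right, ← hR.symm, ← inner_sub_left, h1 w hw, inner_zero_left]
  have h5 : R h = (1 - c) • h := by
    rw [sub_smul, one_smul, ← hc, sub_sub_cancel]
  by_cases hc1 : 1 - c = 0
  · rw [hc1, zero_smul] at h5
    exact h4 (hR.eq_zero_of_apply_eq_zero h5)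
  · refine h3 ((1 - c)⁻¹ • h) ?_
    rw [map_smul, h5, smul_smul, inv_mul_cancel₀ hc1, one_smul]

/-- With `α = 1` and `s = z + 1`, the eigenvalue equation reads `f - s R f = h` and `s ⟨h, f⟩ = -r`,
which `exists_sub_smul_apply_eq` solves with `s < 1`. -/
theorem exists_negative_eigenvector {T V : H →L[ℂ] H}
    (hT : ∀ x y, inner ℂ (T x) y = inner ℂ x (T y)) (hTT : ∀ x, T (T x) = R x)
    (hV : ∀ x y, inner ℂ (V x) y = inner ℂ x (V y)) (hVV : ∀ x, V (V x) = x - R x)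
    (hTh : ∀ k, T k ≠ extResolvent A ψ) (hVh : ∀ k, V k ≠ extResolvent A ψ) (r : ℝ) :
    ∃ z : ℝ, z < 0 ∧ ∃ f : H, f ≠ 0 ∧
      (f, (z : ℂ) • f) ∈ (regularizingOperator A ψ r).graph := by
  obtain ⟨s, hs, f, hf, hfr⟩ :=
    exists_sub_smul_apply_eq hR.symm hR.nonneg hT hTT hV hVV hTh hVh (-r)
  refine ⟨s - 1, by linarith, f, ?_, ?_⟩
  · rintro rfl
    refine hR.extResolvent_ne_zero hψ hψ' ?_
    rw [← hf, map_zero, smul_zero, sub_zero]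
  · have h1 : f + ((s - 1 : ℝ) : ℂ) • f = (s : ℂ) • f := by
      rw [Complex.ofReal_sub, Complex.ofReal_one]
      module
    refine (hR.mem_graph_regularizingOperator hψ hψ').mpr ⟨1, ?_, ?_⟩
    · rw [h1, map_smul, one_smul, ← hf, add_sub_cancel]
    · have h2 : conj (inner ℂ (extResolvent A ψ) f) = inner ℂ (extResolvent A ψ) f := by
        rw [inner_conj_symm, ← hf, inner_sub_left, inner_sub_right, inner_smul_left,
          inner_smul_right, Complex.conj_ofReal, hR.symm]
      rw [h1, inner_smul_right, ← Complex.conj_eq_iff_re.mp h2, ← Complex.ofReal_mul, hfr]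
      simp

/-- Eigenvectors for two negative eigenvalues are orthogonal and span a plane on which the form is
negative; a nonzero combination with boundary value `α = 0` lies in the domain of the nonnegative
`A`. -/
theorem negative_eigenvalue_unique {r z z' : ℝ} (hz : z < 0) (hz' : z' < 0) {f f' : H}
    (hf : f ≠ 0) (hf' : f' ≠ 0) (h : (f, (z : ℂ) • f) ∈ (regularizingOperator A ψ r).graph)
    (h' : (f', (z' : ℂ) • f') ∈ (regularizingOperator A ψ r).graph) : z = z' := by
  by_contra hzz
  have hperp : inner ℂ f f' = 0 := by
    have h1 := (mem_graph_iff_of_isSelfAdjoint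
      (hR.regularizingOperator_isSelfAdjoint hψ hψ' r)).mp h' _ _ h
    rw [inner_smul_left, inner_smul_right, Complex.conj_ofReal, ← sub_mul] at h1
    refine (mul_eq_zero.mp h1).resolve_left (sub_ne_zero.mpr ?_)
    exact_mod_cast hzz
  have hperp' : inner ℂ f' f = 0 := inner_eq_zero_symm.mp hperp
  obtain ⟨α, hα, -⟩ := (hR.mem_graph_regularizingOperator hψ hψ').mp h
  obtain ⟨β, hβ, -⟩ := (hR.mem_graph_regularizingOperator hψ hψ').mp h'
  have hnn : ∀ a b : ℂ, a * α + b * β = 0 →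
      0 ≤ ‖a‖ ^ 2 * z * ‖f‖ ^ 2 + ‖b‖ ^ 2 * z' * ‖f'‖ ^ 2 := by
    intro a b hab
    set e := a • (f + (z : ℂ) • f) + b • (f' + (z' : ℂ) • f') with he
    have h1 : R e = a • f + b • f' := by
      have h2 : a • f + b • f' = R e + (a * α + b * β) • extResolvent A ψ := by
        rw [he, map_add, map_smul, map_smul]
        conv_lhs => rw [hα, hβ]
        module
      rw [h2, hab, zero_smul, add_zero]
    have h3 := hR.nonneg e
    have h4 : e - R e = (a * z) • f + (b * z') • f' := by
      rw [h1, he]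
      module
    have h5 : inner ℂ (e - R e) (R e) =
        ((‖a‖ ^ 2 * z * ‖f‖ ^ 2 + ‖b‖ ^ 2 * z' * ‖f'‖ ^ 2 : ℝ) : ℂ) := by
      rw [h4, h1]
      simp only [inner_add_left, inner_add_right, inner_smul_left, inner_smul_right, hperp, hperp',
        inner_self_ofReal, map_mul, Complex.conj_ofReal]
      push_cast
      rw [← Complex.conj_mul', ← Complex.conj_mul']
      ring
    rwa [h5, Complex.ofReal_re] at h3
  have hfp : 0 < ‖f‖ ^ 2 := by positivity
  have hfp' : 0 < ‖f'‖ ^ 2 := by positivity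
  have hβ0 : β = 0 := by
    have h1 := hnn β (-α) (by ring)
    rw [norm_neg] at h1
    by_contra hβ0
    have h2 : 0 < ‖β‖ ^ 2 := by positivity
    nlinarith [mul_pos h2 hfp, mul_nonneg (sq_nonneg ‖α‖) hfp'.le]
  have h1 := hnn 0 1 (by rw [hβ0]; ring)
  simp only [norm_zero, norm_one] at h1
  nlinarith

end IsResolvent

end Homogeneous

/-! ### Homogeneity of the extensions and the three cases. -/

section Main

attribute [local instance 10000] InnerProductSpace.toInner

variable {H : Type*} [NormedAddCommGroup H] [InnerProductSpace ℂ H]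

theorem HasNegativeEigenvalue.of_mem_graph {B : H →ₗ.[ℂ] H} {z : ℝ} (hz : z < 0) {f : H}
    (hf : f ≠ 0) (h : (f, (z : ℂ) • f) ∈ B.graph) : HasNegativeEigenvalue B := by
  obtain ⟨x, hx, hx'⟩ := (LinearPMap.mem_graph_iff _).mp h
  have hx1 : (x : H) = f := hx
  exact ⟨z, hz, x, by rwa [hx1], by rw [hx1]; exact hx'⟩

variable [CompleteSpace H]

theorem IsHomogeneous.pos {A : H →ₗ.[ℂ] H} (hA : IsSelfAdjoint A) (hA' : IsNonneg A) {T : Set ℝ}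
    {U : T → H ≃ₗᵢ[ℂ] H} {p : T → ℝ} (hp : IsHomogeneous U p A) (t : T) : 0 < p t := by
  obtain ⟨R, hR⟩ := exists_isResolvent hA hA'
  exact hR.pos_of_isHomogeneous hA' hp.1 (fun x => ((hp.2 t).1 x).mp) (hp.2 t).2

namespace IsResolvent

variable {A : H →ₗ.[ℂ] H} {R : H →L[ℂ] H} (hR : IsResolvent A R) (hA : IsSelfAdjoint A)
  (hA' : IsNonneg A) {ψ : A.domain →ₗ⋆[ℂ] ℂ} (hψ : ψ ∈ HMinusTwo A)
  (hψ' : ψ ∉ Set.range (embed A)) {T : Set ℝ} {U : T → H ≃ₗᵢ[ℂ] H}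
  (hU : ∀ t : T, ∃ s : T, U s = (U t).symm) {p ξ : T → ℝ} (hp : IsHomogeneous U p A)
  (hξ : IsInvariantElement A U ξ ψ)

include hR hA hA' hψ hψ' hU hp

theorem isHomogeneous_iff_graphInvariant {B : H →ₗ.[ℂ] H} (hB : restrictKer A ψ ≤ B) :
    IsHomogeneous U p B ↔ ∀ t, GraphInvariant (U t) (p t) B :=
  (isHomogeneous_iff hU fun t => (hp.pos hA hA' t).ne').trans
    (and_iff_right (hR.exists_apply_ne_zero hψ hψ' hB))

include hξ

theorem isHomogeneous_regularizingOperator_iff {r : ℝ} :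
    IsHomogeneous U p (regularizingOperator A ψ r) ↔ SolvesScalarEquation A U p ξ ψ r := by
  have hgr := ((isHomogeneous_iff hU fun t => (hp.pos hA hA' t).ne').mp hp).2
  rw [hR.isHomogeneous_iff_graphInvariant hA hA' hψ hψ' hU hp (LinearPMap.le_of_le_graph
    (hR.restrictKer_graph_le_regularizingOperator hψ hψ' r))]
  exact forall_congr' fun t => hR.graphInvariant_regularizingOperator_iff hψ
    (hp.pos hA hA' t).ne' (hgr t) (hξ t) hψ'

theorem isHomogeneous_symFriedrichs
    (hF : IsSelfAdjointExtension (restrictKer A ψ) (symFriedrichs A hA' ψ)) :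
    IsHomogeneous U p (symFriedrichs A hA' ψ) := by
  have hgr := ((isHomogeneous_iff hU fun t => (hp.pos hA hA' t).ne').mp hp).2
  rw [hR.isHomogeneous_iff_graphInvariant hA hA' hψ hψ' hU hp hF.2]
  exact fun t => hR.graphInvariant_symFriedrichs hψ (hp.pos hA hA' t).ne' (hgr t) (hξ t) hψ' hA'

theorem isHomogeneous_symKrein
    (hK : IsSelfAdjointExtension (restrictKer A ψ) (symKrein A hA' ψ)) :
    IsHomogeneous U p (symKrein A hA' ψ) := by
  have hgr := ((isHomogeneous_iff hU fun t => (hp.pos hA hA' t).ne').mp hp).2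
  rw [hR.isHomogeneous_iff_graphInvariant hA hA' hψ hψ' hU hp hK.2]
  exact fun t => hR.graphInvariant_symKrein hψ (hp.pos hA hA' t).ne' (hgr t) (hξ t) hψ' hA'

/-- If a homogeneous operator `A_sym* ↾ ker ψᵉˣ` has a negative eigenvalue, then `p = 1`, and the
scalar equation is trivial. -/
theorem solvesScalarEquation_of_negative_eigenvector {r z : ℝ} (hz : z < 0) {f : H} (hf : f ≠ 0)
    (hfz : (f, (z : ℂ) • f) ∈ (regularizingOperator A ψ r).graph)
    (hr : SolvesScalarEquation A U p ξ ψ r) (s : ℝ) : SolvesScalarEquation A U p ξ ψ s := by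
  have hgr := ((isHomogeneous_iff hU fun t => (hp.pos hA hA' t).ne').mp hp).2
  intro t
  have hpt := hp.pos hA hA' t
  have h1 := (hR.graphInvariant_regularizingOperator_iff hψ hpt.ne' (hgr t) (hξ t) hψ').mpr (hr t)
  -- `U t f` is an eigenvector for `(p t)⁻¹ z`, again negative, so uniqueness gives `p t = 1`; then
  -- `ξ h = U t h` gives `|ξ t| = 1`.
  have h2 := h1 _ _ hfz
  rw [map_smul, smul_smul, ← Complex.ofReal_inv, ← Complex.ofReal_mul] at h2
  have h3 := hR.negative_eigenvalue_unique hψ hψ' hz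
    (mul_neg_of_pos_of_neg (inv_pos.mpr hpt) hz) hf ((map_ne_zero_iff _ (U t).injective).mpr hf)
    hfz h2
  have hp1 : p t = 1 := by
    rw [eq_inv_mul_iff_mul_eq₀ hpt.ne'] at h3
    exact mul_right_cancel₀ hz.ne (by rw [h3, one_mul])
  have h4 := hR.smul_extResolvent_eq hψ hpt.ne' (hgr t) (hξ t)
  rw [hp1, Complex.ofReal_one, one_smul, add_sub_cancel] at h4
  have h5 := congrArg norm h4
  rw [norm_smul, LinearIsometryEquiv.norm_map, Complex.norm_real, Real.norm_eq_abs] at h5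
  have h6 : |ξ t| = 1 := mul_right_cancel₀
    (norm_ne_zero_iff.mpr (hR.extResolvent_ne_zero hψ hψ')) (by rw [h5, one_mul])
  have h7 : (ξ t : ℂ) ^ 2 = 1 := by
    have h8 : ξ t ^ 2 = 1 := by rw [← sq_abs, h6, one_pow]
    exact_mod_cast h8
  rw [h7, hp1]
  simp

end IsResolvent

end Main

end RankOneSymmetry


theorem mainTheorem8 {H : Type*} [NormedAddCommGroup H] [InnerProductSpace ℂ H] [CompleteSpace H]
    (A₀ : H →ₗ.[ℂ] H) (hA₀ : IsSelfAdjoint A₀) (hA₀_nonneg : IsNonneg A₀)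
    (ψ : A₀.domain →ₗ⋆[ℂ] ℂ) (hψ : ψ ∈ HMinusTwo A₀) (hψ_singular : ψ ∉ Set.range (embed A₀))
    (T : Set ℝ) (U : T → H ≃ₗᵢ[ℂ] H) (hU : ∀ t : T, ∃ s : T, U s = (U t).symm)
    (p ξ : T → ℝ) (hp : IsHomogeneous U p A₀) (hξ : IsInvariantElement A₀ U ξ ψ) :
    ((∀ r : ℝ, ¬ SolvesScalarEquation A₀ U p ξ ψ r) →
      A₀ = symFriedrichs A₀ hA₀_nonneg ψ ∧ A₀ = symKrein A₀ hA₀_nonneg ψ ∧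
      (∀ B : H →ₗ.[ℂ] H,
        (IsSelfAdjointExtension (restrictKer A₀ ψ) B ∧ IsHomogeneous U p B) ↔ B = A₀) ∧
      (∀ B : H →ₗ.[ℂ] H, IsSelfAdjointExtension (restrictKer A₀ ψ) B → B ≠ A₀ →
        HasNegativeEigenvalue B)) ∧
    ((∃ r s : ℝ, r ≠ s ∧
        SolvesScalarEquation A₀ U p ξ ψ r ∧ SolvesScalarEquation A₀ U p ξ ψ s) →
      ∀ B : H →ₗ.[ℂ] H, IsSelfAdjointExtension (restrictKer A₀ ψ) B → IsHomogeneous U p B) ∧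
    ((∃! r : ℝ, SolvesScalarEquation A₀ U p ξ ψ r) →
      symFriedrichs A₀ hA₀_nonneg ψ ≠ symKrein A₀ hA₀_nonneg ψ ∧
      (∀ B : H →ₗ.[ℂ] H,
        (IsSelfAdjointExtension (restrictKer A₀ ψ) B ∧ IsHomogeneous U p B) ↔
          (B = symFriedrichs A₀ hA₀_nonneg ψ ∨ B = symKrein A₀ hA₀_nonneg ψ)) ∧
      ∃ A' : H →ₗ.[ℂ] H,
        (∀ B : H →ₗ.[ℂ] H,
          (IsAdmissibleOperator A₀ hA₀_nonneg ψ B ∧ IsHomogeneous U p B) ↔ B = A') ∧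
        (ψ ∉ HMinusOne A₀ →
          A₀ = symFriedrichs A₀ hA₀_nonneg ψ ∧ A' = symKrein A₀ hA₀_nonneg ψ) ∧
        (ψ ∈ HMinusOne A₀ →
          A₀ = symKrein A₀ hA₀_nonneg ψ ∧ A' = symFriedrichs A₀ hA₀_nonneg ψ)) := by
  obtain ⟨R, hR⟩ := exists_isResolvent hA₀ hA₀_nonneg
  obtain ⟨X, hX, hXX⟩ := exists_symmetric_sqrt hR.symm fun x =>
    (sq_nonneg _).trans (norm_sq_le_re_inner_apply hR.nonneg x)
  obtain ⟨Y, hY, hYY⟩ := exists_symmetric_sqrt (Z := 1 - R)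
    (fun x y => by
      change inner ℂ (x - R x) y = inner ℂ x (y - R y)
      rw [inner_sub_left, inner_sub_right, hR.symm])
    (fun x => by
      change 0 ≤ (inner ℂ (x - R x) x).re
      rw [inner_sub_left, Complex.sub_re, re_inner_self]
      exact sub_nonneg.mpr (re_inner_apply_le_norm_sq hR.nonneg x))
  have hYY' : ∀ x, Y (Y x) = x - R x := hYY
  have hext : ∀ B, IsSelfAdjointExtension (restrictKer A₀ ψ) B ↔
      B = A₀ ∨ ∃ r : ℝ, B = regularizingOperator A₀ ψ r := fun B =>
    hR.isSelfAdjointExtension_iff hψ hψ_singular hA₀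
  have hreg : ∀ r, IsHomogeneous U p (regularizingOperator A₀ ψ r) ↔
      SolvesScalarEquation A₀ U p ξ ψ r := fun r =>
    hR.isHomogeneous_regularizingOperator_iff hA₀ hA₀_nonneg hψ hψ_singular hU hp hξ
  have hneg := hR.exists_negative_eigenvector hψ hψ_singular hX hXX hY hYY'
  have hpos : ∀ (Z : H →L[ℂ] H) k, Z k = extResolvent A₀ ψ → 0 < ‖k‖ ^ 2 := by
    intro Z k hk
    have h1 : k ≠ 0 := by
      rintro rfl
      exact hR.extResolvent_ne_zero hψ hψ_singular (by rw [← hk, map_zero])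
    positivity
  have hF : (ψ ∉ HMinusOne A₀ ∧ (∀ k, X k ≠ extResolvent A₀ ψ) ∧
        symFriedrichs A₀ hA₀_nonneg ψ = A₀) ∨
      ∃ r, 0 < r ∧ ψ ∈ HMinusOne A₀ ∧
        symFriedrichs A₀ hA₀_nonneg ψ = regularizingOperator A₀ ψ r ∧
        SolvesScalarEquation A₀ U p ξ ψ r ∧
        ∀ s, IsAdmissibleNumber A₀ hA₀_nonneg ψ s ↔ s = r := by
    by_cases h : ∃ k, X k = extResolvent A₀ ψ
    · obtain ⟨k, hk⟩ := h
      have h1 := hR.symFriedrichs_eq_regularizingOperator hψ hψ_singular hA₀_nonneg hX hXX hk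
      have h2 := hR.isHomogeneous_symFriedrichs hA₀ hA₀_nonneg hψ hψ_singular hU hp hξ
        ((hext _).mpr (Or.inr ⟨_, h1⟩))
      rw [h1, hreg] at h2
      exact Or.inr ⟨_, hpos X k hk, (hR.mem_HMinusOne_iff hψ hX hXX).mpr ⟨k, hk⟩, h1, h2,
        fun s => hR.isAdmissibleNumber_iff hψ hA₀_nonneg hX hXX hk⟩
    · refine Or.inl ⟨fun h1 => h ((hR.mem_HMinusOne_iff hψ hX hXX).mp h1), not_exists.mp h, ?_⟩
      exact hR.symFriedrichs_eq_self hψ hψ_singular hA₀_nonneg hX hXX (not_exists.mp h)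
  have hN : ((∀ k, Y k ≠ extResolvent A₀ ψ) ∧ symKrein A₀ hA₀_nonneg ψ = A₀) ∨
      ∃ r, r < 0 ∧ symKrein A₀ hA₀_nonneg ψ = regularizingOperator A₀ ψ r ∧
        SolvesScalarEquation A₀ U p ξ ψ r := by
    by_cases h : ∃ k, Y k = extResolvent A₀ ψ
    · obtain ⟨l, hl⟩ := h
      obtain ⟨k, hk', hk⟩ := exists_mem_orthogonal_ker Y l
      rw [hl] at hk
      have h1 := hR.symKrein_eq_regularizingOperator hψ hψ_singular hA₀_nonneg hY hYY' hk hk'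
      have h2 := hR.isHomogeneous_symKrein hA₀ hA₀_nonneg hψ hψ_singular hU hp hξ
        ((hext _).mpr (Or.inr ⟨_, h1⟩))
      rw [h1, hreg] at h2
      exact Or.inr ⟨_, neg_neg_of_pos (hpos Y k hk), h1, h2⟩
    · exact Or.inl ⟨not_exists.mp h,
        hR.symKrein_eq_self hψ hψ_singular hA₀_nonneg hY hYY' (not_exists.mp h)⟩
  refine ⟨fun hno => ?_, ?_, ?_⟩
  · obtain ⟨-, hXh, hFA⟩ : _ ∧ (∀ k, X k ≠ extResolvent A₀ ψ) ∧
        symFriedrichs A₀ hA₀_nonneg ψ = A₀ :=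
      hF.resolve_right fun ⟨r, _, _, _, hr, _⟩ => hno r hr
    obtain ⟨hYh, hNA⟩ := hN.resolve_right fun ⟨r, _, _, hr⟩ => hno r hr
    refine ⟨hFA.symm, hNA.symm, fun B => ⟨?_, ?_⟩, fun B hB hBA => ?_⟩
    · rintro ⟨hB, hB'⟩
      obtain rfl | ⟨r, rfl⟩ := (hext B).mp hB
      · rfl
      · exact absurd ((hreg r).mp hB') (hno r)
    · rintro rfl
      exact ⟨(hext _).mpr (Or.inl rfl), hp⟩
    · obtain ⟨r, rfl⟩ := ((hext B).mp hB).resolve_left hBA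
      obtain ⟨z, hz, f, hf, hfz⟩ := hneg hXh hYh r
      exact HasNegativeEigenvalue.of_mem_graph hz hf hfz
  · rintro ⟨r, s, hrs, hr, hs⟩ B hB
    obtain rfl | ⟨q, rfl⟩ := (hext B).mp hB
    · exact hp
    · refine (hreg q).mpr fun t => ?_
      -- Two distinct solutions kill the coefficient of `r`, hence also the right-hand side.
      have h1 : ((ξ t : ℂ) ^ 2 - (p t : ℂ)) = 0 := by
        have h2 : ((ξ t : ℂ) ^ 2 - (p t : ℂ)) * ((r : ℂ) - s) = 0 := by
          linear_combination hr t - hs t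
        refine (mul_eq_zero.mp h2).resolve_right (sub_ne_zero.mpr ?_)
        exact_mod_cast hrs
      rw [← hr t, h1, zero_mul, zero_mul]
  · rintro ⟨r₀, hr₀, huniq⟩
    have hhom : ∀ B, (IsSelfAdjointExtension (restrictKer A₀ ψ) B ∧ IsHomogeneous U p B) ↔
        (B = A₀ ∨ B = regularizingOperator A₀ ψ r₀) := by
      intro B
      constructor
      · rintro ⟨hB, hB'⟩
        obtain rfl | ⟨r, rfl⟩ := (hext B).mp hB
        · exact Or.inl rfl
        · rw [huniq r ((hreg r).mp hB')]
          exact Or.inr rfl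
      · rintro (rfl | rfl)
        · exact ⟨(hext _).mpr (Or.inl rfl), hp⟩
        · exact ⟨(hext _).mpr (Or.inr ⟨_, rfl⟩), (hreg _).mpr hr₀⟩
    have hne := hR.regularizingOperator_ne hψ hψ_singular r₀
    rcases hF with ⟨hψ1, hXh, hFA⟩ | ⟨r, hrpos, hψ1, hFr, hr, hadm⟩
    · have hNr : symKrein A₀ hA₀_nonneg ψ = regularizingOperator A₀ ψ r₀ := by
        rcases hN with ⟨hYh, -⟩ | ⟨r, -, hNr, hr⟩
        -- If `h` missed both ranges, the negative eigenvalue of the homogeneous `A_r₀` would make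
        -- `r₀ + 1` a second solution.
        · obtain ⟨z, hz, f, hf, hfz⟩ := hneg hXh hYh r₀
          have h1 := huniq (r₀ + 1) (hR.solvesScalarEquation_of_negative_eigenvector hA₀
            hA₀_nonneg hψ hψ_singular hU hp hξ hz hf hfz hr₀ _)
          linarith
        · rw [hNr, huniq r hr]
      rw [hFA, hNr]
      refine ⟨hne.symm, hhom, regularizingOperator A₀ ψ r₀, fun B => ⟨?_, ?_⟩,
        fun _ => ⟨rfl, rfl⟩, fun h => absurd h hψ1⟩
      · rintro ⟨⟨r, -, rfl⟩, hB⟩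
        rw [huniq r ((hreg r).mp hB)]
      · rintro rfl
        exact ⟨⟨r₀, fun h => absurd h hψ1, rfl⟩, (hreg _).mpr hr₀⟩
    · obtain rfl := huniq r hr
      have hNA : symKrein A₀ hA₀_nonneg ψ = A₀ := by
        rcases hN with ⟨-, h⟩ | ⟨s, hs, -, hs'⟩
        · exact h
        -- The single solution would be both the positive Friedrichs parameter and the negative
        -- Krein one.
        · linarith [huniq s hs']
      rw [hFr, hNA]
      refine ⟨hne, fun B => (hhom B).trans or_comm, regularizingOperator A₀ ψ r, fun B => ⟨?_, ?_⟩,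
        fun h => absurd hψ1 h, fun _ => ⟨rfl, rfl⟩⟩
      · rintro ⟨⟨s, hs, rfl⟩, hB⟩
        rw [(hadm s).mp hs]
      · rintro rfl
        exact ⟨⟨r, (hadm r).mpr rfl, rfl⟩, (hreg _).mpr hr⟩
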